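/- **Setting.** Let $N\ge 2$, $t_0\in\mathbb R$, $T>0$, $\mathcal T_p=[t_0,T+t_0)$. Let $\mu$ be of class $\mathcal K_T$: $\mu:\mathcal T_p\to[b,\infty)$ for some $b\ge 0$ is $C^1$ and strictly increasing, $\mu(t)\to\infty$ and $\dot\mu(t)\to\infty$ as $t\to T+t_0$, $\dot\mu(t_0)>0$, and $\dot\mu\le\tilde b\mu^2$ on $\mathcal T_p$ with a constant $\tilde b>0$. Put $\tilde\mu=\dot\mu/\mu$. Let $a_{ij}=a_{ji}\ge 0$, $a_{ii}=0$ ($1\le i,j\le N$) be the weights of an undirected graph ($i,j$ joined iff $a_{ij}>0$), with Laplacian $\mathcal L$, second smallest eigenvalue $\lambda_2$ and largest eigenvalue $\lambda_N$. The agents are Euler–Lagrange systems $$M^i(q^i)\ddot q^i+C^i(q^i,\dot q^i)\dot q^i=\tau^i,\qquad y^i=q^i\in\mathbb R^n,\quad t\ge t_0,$$ with $M^i$ differentiable, satisfying for all arguments: (P1) $\dot M^i(q)-2C^i(q,\dot q)$ is skew-symmetric, where $\dot M^i(q)=DM^i(q)[\dot q]$; (P2) $M^i(q)x_1+C^i(q,\dot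 q)x_2=\Omega^i(q,\dot q,x_1,x_2)\theta^i$ with a constant vector $\theta^i\in\mathbb R^p$, $\Omega^i(q,0,0,0)=0$ and $\|\Omega^i(q,\dot q,x_1,x_2)\|\le\rho^i(\|w\|+\|w\|^2)$, $w=(\dot q,x_1,x_2)$, $\rho^i>0$; (P3) $M^i(q)$ is symmetric with $k_{\underline m}^iI\le M^i(q)\le k_{\overline m}^iI$, where $k_{\underline m}^i,k_{\overline m}^i>0$. Assume: (A1) the graph is connected; (A2) the problem $\min\sum_i f^i(y^i)$ subject to $y^i=y^j$ for all $i,j$ has finite optimal value and a nonempty compact set of optimal solutions; (A3) each $f^i:\mathbb R^n\to\mathbb R$ is differentiable, with $(\nabla f^i(x_1)-\nabla f^i(x_2))^{\mathsf T}(x_1-x_2)\ge\rho_c\|x_1-x_2\|^2$ and $\|\nabla f^i(x_1)-\nabla f^i(x_2)\|\le\varrho_c\|x_1-x_2\|$, where $\rho_c,\varrho_c>0$. **Closed loop.** For $t\in\mathcal T_p$, with $\chi_y^i=\sum_j a_{ij}(y^i-y^j)$, $s^i=\dot q^i+k_1^i\mu(y^i-\varpi^i)$, $z_1^i=((\iota-1)\tilde\mu+k_1^i\mu)\dot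 q^i+\iota k_1^i\mu\tilde\mu(y^i-\varpi^i)$, $z_2^i=k_1^i\mu(y^i-\varpi^i)$ and $\Omega^i=\Omega^i(q^i,\dot q^i,z_1^i,z_2^i)$, $$\dot\varpi^i=-c\mu(\nabla f^i(y^i)+\chi_y^i+v^i),\quad \dot v^i=c\mu\chi_y^i,\quad \tau^i=-k_2^i\mu s^i-\Omega^i\hat\theta^i,\quad \dot{\hat\theta}^i=2\mu^{2\iota-2}(\Omega^i)^{\mathsf T}s^i-\sigma^i\mu\hat\theta^i,$$ while $\dot\varpi^i=\dot v^i=0$ and $\tau^i=0$ for $t\ge T+t_0$ ($\hat\theta^i$ exists on $\mathcal T_p$ only). The states $q^i,\dot q^i,\varpi^i,v^i$ are continuous in $t$, and the auxiliary states are initialized with $\sum_{i}v^i(t_0)=0$. **Design criteria.** Let $\delta=\max\{4/\lambda_2,(4\varrho_c^2+1)/\rho_c\}$, $\bar\delta=\tfrac{\delta}{2}\max\{1,\lambda_2^{-1}\}+\tfrac12$, $\underline\delta=\tfrac\delta2\min\{1,\lambda_N^{-1}\}$, $c_\Delta=c\big(\tfrac{\varrho_c^2\delta}{2\rho_c}+\tfrac{\lambda_N^2\delta}{2\lambda_2}+2\delta^2+\tfrac{\varrho_c^2}{2\rho_c}+2\varrho_c^2\big)$,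 $c_s=4c^2(2\lambda_N+\varrho_c+1)^2$. Assume (DC1) $\iota>2$; (DC2) $c=2\bar\delta c^*+4\iota\tilde b+4\bar\delta\iota\tilde b$ for some $c^*>0$; (DC3) $\min_i\sigma^i>\max\{\tilde b,\,c_\Delta c_s/(c^*\underline\delta)\}$; (DC4) $k_1^i=k_1^{i,*}+\tilde b\iota+1$ and $k_2^i=k_2^{i,*}+\tfrac12(k_1^i)^2(k_{\overline m}^i)^2+\tfrac12$, with $\min_ik_1^{i,*}>\tfrac{c_s}{2}\big(\tfrac{c_\Delta}{c^*\underline\delta}+1\big)$ and $k_2^{i,*}>\tfrac{c_\Delta c_sk_{\overline m}^i}{2c^*\underline\delta}$. **Conclusion.** The optimization problem has a unique optimal solution $y^i=z^*$ ($1\le i\le N$), and: 1. For every closed-loop solution on $[t_0,\infty)$ and every $i$, $y^i(t)\to z^*$ as $t\to T+t_0$, and $y^i(t)=z^*$ for all $t\ge T+t_0$. 2. For every such solution, $q^i,\dot q^i,\tau^i,\varpi^i,v^i$ are bounded on $[t_0,\infty)$ and $\hat\theta^i$ is bounded on $\mathcal T_p$. 3. Let $e(t)$ be the stacked vector of all $\varpi^i-z^*$,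 $v^i+\nabla f^i(z^*)$, $y^i-\varpi^i$, $\dot q^i$. For every $R$ there is $\beta\in\mathcal{KL}_T^e$ such that every closed-loop solution with $\big(\sum_i\|\theta^i-\hat\theta^i(t_0)\|^2\big)^{1/2}\le R$ satisfies $\|e(t)\|\le\beta(\|e(t_0)\|,t-t_0)$ for all $t\ge t_0$. Here $\beta\in\mathcal{KL}_T^e$ means: $\beta:[0,\infty)^2\to[0,\infty)$ is continuous; for each $s\in[0,T)$, $\beta(\cdot,s)$ is strictly increasing and unbounded with $\beta(0,s)>0$; for each $r$, $\beta(r,\cdot)$ is strictly decreasing on $[0,T)$, tends to $0$ as $s\to T$, and vanishes on $[T,\infty)$. The same holds for a solution that is given only on $[t_0,t_{\mathrm{end}})$, $t_0<t_{\mathrm{end}}\le\infty$: statements 2 and 3 hold on $[t_0,t_{\mathrm{end}})$, with $\beta$ independent of $t_{\mathrm{end}}$, and statement 1 holds there if $t_{\mathrm{end}}>T+t_0$. -/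

import Mathlib

open Set Filter Topology
open scoped BigOperators

noncomputable section

namespace DPTCO

/-- `ℝ^n` with the Euclidean norm. -/
abbrev Vec (n : ℕ) : Type := EuclideanSpace ℝ (Fin n)

/-! ### Time axis and time-varying gains -/

/-- The interval `[t₀, T + t₀)`. -/
def Tp (t0 T : ℝ) : Set ℝ := Ico t0 (T + t0)

/-- The time derivative of a function that matters on `[t₀, T + t₀)` only. -/
def rate (t0 T : ℝ) (μ : ℝ → ℝ) (t : ℝ) : ℝ := derivWithin μ (Tp t0 T) t

/-- Class `𝒦_T`, with the constant `bt` (written `b̃`) of the bound `μ' ≤ b̃ μ²`. -/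
structure ClassKT (t0 T bt : ℝ) (μ : ℝ → ℝ) : Prop where
  range_bound : ∃ b : ℝ, 0 ≤ b ∧ ∀ t ∈ Tp t0 T, b ≤ μ t
  contDiff : ContDiffOn ℝ 1 μ (Tp t0 T)
  strictMono : StrictMonoOn μ (Tp t0 T)
  tendsto_top : Tendsto μ (𝓝[<] (T + t0)) atTop
  rate_init : 0 < rate t0 T μ t0
  rate_top : Tendsto (rate t0 T μ) (𝓝[<] (T + t0)) atTop
  bt_pos : 0 < bt
  rate_le : ∀ t ∈ Tp t0 T, rate t0 T μ t ≤ bt * μ t ^ 2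

/-- Class `𝒦_∞^e`: continuous, strictly increasing and unbounded on `[0, ∞)`, positive at `0`. -/
structure ClassKInfE (α : ℝ → ℝ) : Prop where
  cont : ContinuousOn α (Ici 0)
  strictMono : StrictMonoOn α (Ici 0)
  pos : 0 < α 0
  unbounded : Tendsto α atTop atTop

/-- Class `𝒦ℒ_T^e`. As `β (r, s) = 0` for `s ≥ T`, growth in `r` is asked for `s < T`. -/
structure ClassKLTE (T : ℝ) (β : ℝ → ℝ → ℝ) : Prop where
  cont : ContinuousOn (fun x : ℝ × ℝ => β x.1 x.2) (Ici 0 ×ˢ Ici 0)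
  nonneg : ∀ r, 0 ≤ r → ∀ s, 0 ≤ s → 0 ≤ β r s
  growth : ∀ s ∈ Ico 0 T, ClassKInfE (fun r => β r s)
  decreasing : ∀ r, 0 ≤ r → StrictAntiOn (β r) (Ico 0 T)
  tendsto_zero : ∀ r, 0 ≤ r → Tendsto (β r) (𝓝[<] T) (𝓝 0)
  eq_zero : ∀ r, 0 ≤ r → ∀ s, T ≤ s → β r s = 0

/-! ### Communication graph -/

/-- The weighted adjacency matrix of an undirected graph on `N` nodes without self edges. -/
structure WGraph (N : ℕ) where
  a : Fin N → Fin N → ℝ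
  nonneg : ∀ i j, 0 ≤ a i j
  symm : ∀ i j, a i j = a j i
  diag : ∀ i, a i i = 0

/-- The underlying graph: `i` and `j` are joined iff the weight is positive. -/
def WGraph.graph {N : ℕ} (G : WGraph N) : SimpleGraph (Fin N) where
  Adj i j := 0 < G.a i j
  symm := ⟨fun i j h => by rw [G.symm j i]; exact h⟩
  loopless := ⟨fun i h => by rw [G.diag i] at h; exact lt_irrefl _ h⟩

/-- The Laplacian matrix. -/
def WGraph.laplacian {N : ℕ} (G : WGraph N) : Matrix (Fin N) (Fin N) ℝ :=
  Matrix.of fun i j => if i = j then ∑ k, G.a i k else -G.a i j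

/-- `λ₂`: zero being a simple eigenvalue of the Laplacian of a connected graph and all the others
being positive, `λ₂` is the least positive eigenvalue. -/
def WGraph.lam2 {N : ℕ} (G : WGraph N) : ℝ := sInf {x ∈ spectrum ℝ G.laplacian | 0 < x}

/-- `λ_N`, the largest eigenvalue of the Laplacian. -/
def WGraph.lamMax {N : ℕ} (G : WGraph N) : ℝ := sSup (spectrum ℝ G.laplacian)

/-! ### Euler–Lagrange subsystems -/

/-- The data of one subsystem. Matrices are written as the linear maps they represent:
inertia matrix `M(q)`, centripetal and Coriolis matrix `C(q, q')`, regression matrix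
`Ω(q, q', x₁, x₂)`, vector `θ` of inertial parameters. -/
structure Plant (n p : ℕ) where
  M : Vec n → (Vec n →L[ℝ] Vec n)
  C : Vec n → Vec n → (Vec n →L[ℝ] Vec n)
  Ω : Vec n → Vec n → Vec n → Vec n → (Vec p →L[ℝ] Vec n)
  θ : Vec p

/-- `M` is differentiable and `M' - 2 C` is skew-symmetric, where `M' = DM(q)[q']` is the time
derivative of `M(q)` along a motion through `q` with velocity `q'`. -/
structure Plant.SkewProperty {n p : ℕ} (P : Plant n p) : Prop where
  diff : Differentiable ℝ P.M
  skew : ∀ q dq : Vec n,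
    ContinuousLinearMap.adjoint (fderiv ℝ P.M q dq - (2 : ℝ) • P.C q dq)
      = -(fderiv ℝ P.M q dq - (2 : ℝ) • P.C q dq)

/-- Linear parametrization with the growth bound for `Ω`;
`w` is the stacked vector `(q', x₁, x₂)`. -/
structure Plant.RegressionProperty {n p : ℕ} (P : Plant n p) (ρ : ℝ) : Prop where
  ρ_pos : 0 < ρ
  param : ∀ q dq x₁ x₂ : Vec n, P.M q x₁ + P.C q dq x₂ = P.Ω q dq x₁ x₂ P.θ
  zero : ∀ q : Vec n, P.Ω q 0 0 0 = 0
  bound : ∀ q dq x₁ x₂ : Vec n,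
    ‖P.Ω q dq x₁ x₂‖ ≤
      ρ * (Real.sqrt (‖dq‖ ^ 2 + ‖x₁‖ ^ 2 + ‖x₂‖ ^ 2) + (‖dq‖ ^ 2 + ‖x₁‖ ^ 2 + ‖x₂‖ ^ 2))

/-- `kl I ≤ M(q) ≤ ku I` in the order of symmetric operators. -/
structure Plant.InertiaProperty {n p : ℕ} (P : Plant n p) (kl ku : ℝ) : Prop where
  kl_pos : 0 < kl
  ku_pos : 0 < ku
  lower : ∀ q : Vec n, kl • (1 : Vec n →L[ℝ] Vec n) ≤ P.M q
  upper : ∀ q : Vec n, P.M q ≤ ku • (1 : Vec n →L[ℝ] Vec n)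

/-! ### The optimization problem -/

/-- The values `∑ f^i(y^i)` at the feasible points, which are `y = 1_N ⊗ z`. -/
def feasibleValues {N n : ℕ} (f : Fin N → Vec n → ℝ) : Set ℝ :=
  {r | ∃ y : Fin N → Vec n, (∀ i j, y i = y j) ∧ r = ∑ i, f i (y i)}

/-- The optimal value `f*`. -/
def optValue {N n : ℕ} (f : Fin N → Vec n → ℝ) : ℝ := sInf (feasibleValues f)

/-- The set `Y_opt` of optimal solutions. -/
def optSet {N n : ℕ} (f : Fin N → Vec n → ℝ) : Set (Fin N → Vec n) :=
  {y | (∀ i j, y i = y j) ∧ ∑ i, f i (y i) = optValue f}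

/-- The optimal value is finite; the optimal set is nonempty and compact. -/
structure Solvable {N n : ℕ} (f : Fin N → Vec n → ℝ) : Prop where
  finite_value : BddBelow (feasibleValues f)
  nonempty : (optSet f).Nonempty
  compact : IsCompact (optSet f)

/-- Each `f^i` is differentiable, `ρc`-strongly convex, with `vc`-Lipschitz gradient. -/
structure CostAssumption {N n : ℕ} (f : Fin N → Vec n → ℝ) (ρc vc : ℝ) : Prop where
  ρc_pos : 0 < ρc
  vc_pos : 0 < vc
  diff : ∀ i, Differentiable ℝ (f i)
  strong : ∀ i, ∀ x₁ x₂ : Vec n,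
    ρc * ‖x₁ - x₂‖ ^ 2 ≤ inner ℝ (gradient (f i) x₁ - gradient (f i) x₂) (x₁ - x₂)
  lipschitz : ∀ i, ∀ x₁ x₂ : Vec n,
    ‖gradient (f i) x₁ - gradient (f i) x₂‖ ≤ vc * ‖x₁ - x₂‖

/-! ### Design parameters and design criteria -/

/-- The design parameters `c`, `ι`, `k₁^i`, `k₂^i`, `σ^i`. -/
structure Params (N : ℕ) where
  c : ℝ
  ι : ℝ
  k1 : Fin N → ℝ
  k2 : Fin N → ℝ
  σ : Fin N → ℝ

/-- `δ = max {4/λ₂, (4 ϱ_c² + 1)/ρ_c}`. -/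
def delta (lam2 ρc vc : ℝ) : ℝ := max (4 / lam2) ((4 * vc ^ 2 + 1) / ρc)

/-- `δ̄ = δ max {1, λ₂⁻¹}/2 + 1/2`. -/
def deltaUp (lam2 ρc vc : ℝ) : ℝ := delta lam2 ρc vc * max 1 lam2⁻¹ / 2 + 1 / 2

/-- `δ̲ = δ min {1, λ_N⁻¹}/2`. -/
def deltaLow (lam2 lamN ρc vc : ℝ) : ℝ := delta lam2 ρc vc * min 1 lamN⁻¹ / 2

/-- `c_Δ`. -/
def cDelta (lam2 lamN ρc vc c : ℝ) : ℝ :=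
  c * (vc ^ 2 * delta lam2 ρc vc / (2 * ρc) + lamN ^ 2 * delta lam2 ρc vc / (2 * lam2)
    + 2 * delta lam2 ρc vc ^ 2 + vc ^ 2 / (2 * ρc) + 2 * vc ^ 2)

/-- `c_s`. -/
def cS (lamN vc c : ℝ) : ℝ := 4 * c ^ 2 * (2 * lamN + vc + 1) ^ 2

/-- The four design criteria, with the free constants `c*`, `k₁^{i,*}`, `k₂^{i,*}`. -/
structure DesignCriteria {N : ℕ} (G : WGraph N) (ρc vc bt : ℝ) (ku : Fin N → ℝ)
    (η : Params N) (cst : ℝ) (k1st k2st : Fin N → ℝ) : Prop where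
  dc1 : 2 < η.ι
  cst_pos : 0 < cst
  dc2 : η.c = 2 * deltaUp G.lam2 ρc vc * cst + 4 * η.ι * bt
    + 4 * deltaUp G.lam2 ρc vc * η.ι * bt
  dc3 : ∀ i, max bt (cDelta G.lam2 G.lamMax ρc vc η.c * cS G.lamMax vc η.c
      / (cst * deltaLow G.lam2 G.lamMax ρc vc)) < η.σ i
  dc4_k1 : ∀ i, η.k1 i = k1st i + bt * η.ι + 1
  dc4_k2 : ∀ i, η.k2 i = k2st i + (1 / 2) * η.k1 i ^ 2 * ku i ^ 2 + 1 / 2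
  dc4_k1st : ∀ i, cS G.lamMax vc η.c * (cDelta G.lam2 G.lamMax ρc vc η.c
      / (cst * deltaLow G.lam2 G.lamMax ρc vc) + 1) / 2 < k1st i
  dc4_k2st : ∀ i, cDelta G.lam2 G.lamMax ρc vc η.c * cS G.lamMax vc η.c * ku i
      / (2 * cst * deltaLow G.lam2 G.lamMax ρc vc) < k2st i

/-! ### The closed loop -/

/-- The signals of the closed loop: position, velocity, acceleration, the auxiliary states
`ϖ` and `v`, and the parameter estimate. -/
structure Signals (N n p : ℕ) where
  q : ℝ → Fin N → Vec n
  dq : ℝ → Fin N → Vec n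
  ddq : ℝ → Fin N → Vec n
  ϖ : ℝ → Fin N → Vec n
  v : ℝ → Fin N → Vec n
  θhat : ℝ → Fin N → Vec p

/-- The output `y^i = q^i`. -/
def Signals.y {N n p : ℕ} (S : Signals N n p) : ℝ → Fin N → Vec n := S.q

/-- Everything that fixes the closed-loop equations. -/
structure Loop (N n p : ℕ) where
  t0 : ℝ
  T : ℝ
  μ : ℝ → ℝ
  G : WGraph N
  plant : Fin N → Plant n p
  f : Fin N → Vec n → ℝ
  η : Params N

section ClosedLoop

variable {N n p : ℕ} (L : Loop N n p) (S : Signals N n p)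

/-- The relative output information `χ_y^i = ∑_j a_ij (y^i - y^j)`. -/
def relInfo (t : ℝ) (i : Fin N) : Vec n := ∑ j, L.G.a i j • (S.y t i - S.y t j)

/-- `μ̃ = μ' / μ`. -/
def muTilde (t : ℝ) : ℝ := rate L.t0 L.T L.μ t / L.μ t

/-- The intermediate variable `z₁^i`. -/
def z1 (t : ℝ) (i : Fin N) : Vec n :=
  ((L.η.ι - 1) * muTilde L t + L.η.k1 i * L.μ t) • S.dq t i
    + (L.η.ι * L.η.k1 i * L.μ t * muTilde L t) • (S.y t i - S.ϖ t i)

/-- The intermediate variable `z₂^i`. -/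
def z2 (t : ℝ) (i : Fin N) : Vec n :=
  (L.η.k1 i * L.μ t) • (S.y t i - S.ϖ t i)

/-- The regression matrix `Ω^i(q^i, q'^i, z₁^i, z₂^i)` along the closed loop. -/
def regr (t : ℝ) (i : Fin N) : Vec p →L[ℝ] Vec n :=
  (L.plant i).Ω (S.q t i) (S.dq t i) (z1 L S t i) (z2 L S t i)

/-- The control law `π^i`. -/
def ctrl (t : ℝ) (i : Fin N) : Vec n :=
  -((L.η.k2 i * L.μ t) • (S.dq t i + (L.η.k1 i * L.μ t) • (S.y t i - S.ϖ t i)))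
    - regr L S t i (S.θhat t i)

open Classical in
/-- The control input: `τ^i = π^i` before `T + t₀` and `τ^i = 0` from then on. -/
def τ (t : ℝ) (i : Fin N) : Vec n := if t < L.T + L.t0 then ctrl L S t i else 0

/-- The adaptation term `ς^i = 2 μ^{2ι-2} Ωᵀ (q'^i + k₁^i μ (y^i - ϖ^i))`. -/
def adapt (t : ℝ) (i : Fin N) : Vec p :=
  (2 * L.μ t ^ (2 * L.η.ι - 2)) •
    ContinuousLinearMap.adjoint (regr L S t i)
      (S.dq t i + (L.η.k1 i * L.μ t) • (S.y t i - S.ϖ t i))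

/-- The time interval `[t₀, tEnd)`, where `tEnd` may be `∞`. -/
def timeDom (t0 : ℝ) (tEnd : EReal) : Set ℝ := {t | t0 ≤ t ∧ (t : EReal) < tEnd}

/-- `S` is a closed-loop solution on `[t₀, tEnd)`: the states are continuous and satisfy the
equations before `T + t₀` and from `T + t₀` on (where derivatives at the endpoint are one-sided).
The estimate lives before `T + t₀` only. -/
structure IsSolution (tEnd : EReal) : Prop where
  pos_eq : ∀ t ∈ timeDom L.t0 tEnd, ∀ i,
    HasDerivWithinAt (fun s => S.q s i) (S.dq t i) (Ici L.t0) t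
  dq_cont : ∀ i, ContinuousOn (fun s => S.dq s i) (timeDom L.t0 tEnd)
  ϖ_cont : ∀ i, ContinuousOn (fun s => S.ϖ s i) (timeDom L.t0 tEnd)
  v_cont : ∀ i, ContinuousOn (fun s => S.v s i) (timeDom L.t0 tEnd)
  vel_eq : ∀ t ∈ timeDom L.t0 tEnd, t < L.T + L.t0 → ∀ i,
    HasDerivWithinAt (fun s => S.dq s i) (S.ddq t i) (Ici L.t0) t
  vel_eq' : ∀ t ∈ timeDom L.t0 tEnd, L.T + L.t0 ≤ t → ∀ i,
    HasDerivWithinAt (fun s => S.dq s i) (S.ddq t i) (Ici (L.T + L.t0)) t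
  euler_lagrange : ∀ t ∈ timeDom L.t0 tEnd, ∀ i,
    (L.plant i).M (S.q t i) (S.ddq t i) + (L.plant i).C (S.q t i) (S.dq t i) (S.dq t i)
      = τ L S t i
  ϖ_eq : ∀ t ∈ timeDom L.t0 tEnd, t < L.T + L.t0 → ∀ i,
    HasDerivWithinAt (fun s => S.ϖ s i)
      (-((L.η.c * L.μ t) • (gradient (L.f i) (S.y t i) + relInfo L S t i + S.v t i)))
      (Ici L.t0) t
  v_eq : ∀ t ∈ timeDom L.t0 tEnd, t < L.T + L.t0 → ∀ i,
    HasDerivWithinAt (fun s => S.v s i) ((L.η.c * L.μ t) • relInfo L S t i) (Ici L.t0) t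
  ϖ_eq' : ∀ t ∈ timeDom L.t0 tEnd, L.T + L.t0 ≤ t → ∀ i,
    HasDerivWithinAt (fun s => S.ϖ s i) 0 (Ici (L.T + L.t0)) t
  v_eq' : ∀ t ∈ timeDom L.t0 tEnd, L.T + L.t0 ≤ t → ∀ i,
    HasDerivWithinAt (fun s => S.v s i) 0 (Ici (L.T + L.t0)) t
  θhat_eq : ∀ t ∈ timeDom L.t0 tEnd, t < L.T + L.t0 → ∀ i,
    HasDerivWithinAt (fun s => S.θhat s i)
      (adapt L S t i - (L.η.σ i * L.μ t) • S.θhat t i) (Ici L.t0) t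

/-- The norm of the stacked error `(e_r, e_s)`, where `e_r = (ϖ - 1⊗z, v + ∇F(1⊗z))` and
`e_s = (y - ϖ, q')`. -/
def errNorm (z : Vec n) (t : ℝ) : ℝ :=
  Real.sqrt (∑ i, (‖S.ϖ t i - z‖ ^ 2 + ‖S.v t i + gradient (L.f i) z‖ ^ 2
    + ‖S.y t i - S.ϖ t i‖ ^ 2 + ‖S.dq t i‖ ^ 2))

/-- The norm of the stacked estimation error `θ - θ̂`. -/
def estErrNorm (t : ℝ) : ℝ := Real.sqrt (∑ i, ‖(L.plant i).θ - S.θhat t i‖ ^ 2)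

end ClosedLoop

end DPTCO

end

namespace DPTCO

/-! ### Spectral decomposition of the Laplacian -/

section Spectral

variable {N : ℕ} (G : WGraph N)

/-! The idea is to scale the errors so that convergence becomes boundedness. Multiply `ϖ - z`, `v +
∇f(z)` and `y - ϖ` by `μ^ι`, and the sliding variable `s = q' + k₁ μ (y - ϖ)` by `μ^(ι-1)`. Apart
from the regression term, which the adaptation law cancels, the scaled errors obey equations of the
form `μ` times an expression in which `μ` survives only through `growth = ι μ'/μ²`, and `μ' ≤ b̃ μ²`
confines that to `[0, ι b̃]`. The design gains outweigh this growth.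

A Lyapunov function `V` then satisfies `V' ≤ μ (-a V + b)`, where `b` comes from the leakage term `σ
μ θ̂` (`exists_lyap_deriv_le`). Hence `V` stays below `V(t₀) + b/a + 1`, and undoing the scaling
shows that the original error is `O(μ^(1-ι))`. The exponent is `ι - 1` because `q'` is controlled
through `s`. Convergence at the prescribed time follows from `μ → ∞` alone.

`V` has two layers. The reference layer is a primal-dual gradient flow for `(ϖ, v)`. Its function
`lyapRef` weights the dual error by the pseudoinverse of the Laplacian, so that the primal-dual
cross terms cancel, and contains `‖x + w‖²/2`, which makes the dual error dissipate. The tracking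
layer `lyapTrack` adds the inertia energy of `s` and the estimation error; skew-symmetry removes the
derivative of `M`, and the adaptation law cancels the parameter error. The layers disturb each
other: the gap `y - ϖ` enters the first with weight `c_Δ`, the reference velocity the second with
weight `c_s/2`. The design criteria are the small-gain condition under which `trackWeight` balances
the two (`exists_rate`).

Bounded inputs need `ι > 2`: `μ s` and `μ² (y - ϖ)` are then scaled errors times `μ^(2-ι)`. At `T +
t₀` the error vanishes by continuity. With zero input the kinetic energy is conserved, so the agents
remain at rest (`rest`). -/

theorem WGraph.laplacian_isHermitian : G.laplacian.IsHermitian := by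
  ext i j
  simp only [Matrix.conjTranspose_apply, WGraph.laplacian, Matrix.of_apply, star_trivial]
  by_cases h : i = j
  · subst h; simp
  · simp [h, Ne.symm h, G.symm i j]

/-- The Laplacian acting on a family of vectors. -/
def WGraph.lap {E : Type*} [AddCommGroup E] [Module ℝ E] (x : Fin N → E) (i : Fin N) : E :=
  ∑ j, G.a i j • (x i - x j)

theorem WGraph.lap_eq {E : Type*} [AddCommGroup E] [Module ℝ E] (x : Fin N → E) (i : Fin N) :
    G.lap x i = ∑ j, G.laplacian i j • x j := by
  have h : ∀ j, G.laplacian i j • x j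
      = (if i = j then (∑ k, G.a i k) • x i else 0) - G.a i j • x j := by
    intro j
    by_cases h : i = j
    · subst h; simp [WGraph.laplacian, G.diag]
    · simp [WGraph.laplacian, h]
  simp only [h, Finset.sum_sub_distrib, Finset.sum_ite_eq, Finset.mem_univ, if_true]
  simp only [WGraph.lap, smul_sub, Finset.sum_sub_distrib, Finset.sum_smul]

theorem WGraph.sum_lap {E : Type*} [AddCommGroup E] [Module ℝ E] (x : Fin N → E) :
    ∑ i, G.lap x i = 0 := by
  have h1 : ∑ i, G.lap x i = ∑ i, ∑ j, G.a i j • x i - ∑ i, ∑ j, G.a i j • x j := by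
    simp only [WGraph.lap, smul_sub, Finset.sum_sub_distrib]
  rw [h1, Finset.sum_comm (f := fun i j => G.a i j • x j), sub_eq_zero]
  exact Finset.sum_congr rfl fun i _ => Finset.sum_congr rfl fun j _ => by rw [G.symm]

/-- Symmetrization in `i` and `j`. This Dirichlet form yields both the nonnegativity of the
eigenvalues and the description of the kernel. -/
theorem WGraph.two_mul_sum_mul_lap (x : Fin N → ℝ) :
    2 * ∑ i, x i * G.lap x i = ∑ i, ∑ j, G.a i j * (x i - x j) ^ 2 := by
  have h1 : ∑ i, x i * G.lap x i = ∑ i, ∑ j, G.a i j * (x i * (x i - x j)) := by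
    refine Finset.sum_congr rfl fun i _ => ?_
    rw [WGraph.lap, Finset.mul_sum]
    exact Finset.sum_congr rfl fun j _ => by rw [smul_eq_mul]; ring
  have h2 : ∑ i, x i * G.lap x i = ∑ i, ∑ j, G.a i j * (x j * (x j - x i)) := by
    rw [h1, Finset.sum_comm]
    exact Finset.sum_congr rfl fun i _ => Finset.sum_congr rfl fun j _ => by rw [G.symm]
  rw [two_mul]
  nth_rewrite 1 [h1]
  rw [h2, ← Finset.sum_add_distrib]
  refine Finset.sum_congr rfl fun i _ => ?_
  rw [← Finset.sum_add_distrib]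
  exact Finset.sum_congr rfl fun j _ => by ring

/-- The Dirichlet form vanishes, so `x` agrees across every edge, hence along a walk from `i` to
`k`. -/
theorem WGraph.const_of_lap_eq_zero (hG : G.graph.Connected) {x : Fin N → ℝ}
    (h : ∀ i, G.lap x i = 0) (i k : Fin N) : x i = x k := by
  have h0 := G.two_mul_sum_mul_lap x
  simp only [h, mul_zero, Finset.sum_const_zero] at h0
  have hnn : ∀ i j, 0 ≤ G.a i j * (x i - x j) ^ 2 :=
    fun i j => mul_nonneg (G.nonneg i j) (sq_nonneg _)
  have hadj : ∀ i j, G.graph.Adj i j → x i = x j := by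
    intro i j hij
    have h1 := (Finset.sum_eq_zero_iff_of_nonneg
      (fun i _ => Finset.sum_nonneg fun j _ => hnn i j)).1 h0.symm i (Finset.mem_univ i)
    have h2 := (Finset.sum_eq_zero_iff_of_nonneg (fun j _ => hnn i j)).1 h1 j (Finset.mem_univ j)
    have hpos : 0 < G.a i j := hij
    have h3 := (mul_eq_zero.1 h2).resolve_left hpos.ne'
    exact sub_eq_zero.1 (pow_eq_zero_iff two_ne_zero |>.1 h3)
  obtain ⟨w⟩ := hG.preconnected i k
  induction w with
  | nil => rfl
  | cons hd _ ih => exact (hadj _ _ hd).trans ih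

/-- An orthonormal system `U j` of eigenvectors of the Laplacian with eigenvalues `lam j`. -/
structure Modes (U : Fin N → Fin N → ℝ) (lam : Fin N → ℝ) : Prop where
  complete : ∀ i k, ∑ j, U j i * U j k = if i = k then 1 else 0
  action : ∀ j k, G.lap (U j) k = lam j * U j k
  gap : ∀ j, lam j = 0 ∨ G.lam2 ≤ lam j
  upper : ∀ j, lam j ≤ G.lamMax
  const : ∀ j, lam j = 0 → ∀ i k, U j i = U j k

theorem WGraph.exists_modes (hN : 2 ≤ N) (hG : G.graph.Connected) :
    0 < G.lam2 ∧ G.lam2 ≤ G.lamMax ∧ ∃ U lam, Modes G U lam := by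
  have hA := G.laplacian_isHermitian
  set b := hA.eigenvectorBasis with hb
  set lam := hA.eigenvalues with hlam
  have hspec : spectrum ℝ G.laplacian = range lam := hA.spectrum_real_eq_range_eigenvalues
  have hfin : (spectrum ℝ G.laplacian).Finite := hspec ▸ finite_range lam
  have action : ∀ j k, G.lap (fun i => b j i) k = lam j * b j k := by
    intro j k
    have h := congrFun (hA.mulVec_eigenvectorBasis j) k
    simp only [Matrix.mulVec, dotProduct, Pi.smul_apply, smul_eq_mul] at h
    rw [G.lap_eq]
    simpa using h
  have const : ∀ j, lam j = 0 → ∀ i k, b j i = b j k := by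
    intro j hj
    exact G.const_of_lap_eq_zero hG (fun i => by rw [action, hj, zero_mul])
  have normb : ∀ j, ∑ i, b j i * b j i = 1 := by
    intro j
    have h := b.orthonormal.1 j
    have h2 : inner ℝ (b j) (b j) = 1 := by rw [real_inner_self_eq_norm_sq, h]; norm_num
    rw [PiLp.inner_apply] at h2
    simpa only [RCLike.inner_apply, conj_trivial] using h2
  have nonneg : ∀ j, 0 ≤ lam j := by
    intro j
    have h := G.two_mul_sum_mul_lap (fun i => b j i)
    have h1 : ∑ i, b j i * G.lap (fun i => b j i) i = lam j := by
      simp only [action]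
      conv_rhs => rw [← mul_one (lam j), ← normb j, Finset.mul_sum]
      exact Finset.sum_congr rfl fun i _ => by ring
    rw [h1] at h
    have h2 : 0 ≤ ∑ i, ∑ k, G.a i k * (b j i - b j k) ^ 2 :=
      Finset.sum_nonneg fun i _ => Finset.sum_nonneg fun k _ =>
        mul_nonneg (G.nonneg i k) (sq_nonneg _)
    linarith
  -- Here `2 ≤ N` enters: if all eigenvalues were zero, all eigenvectors would be constant, but two
  -- constant unit vectors cannot be orthogonal. The set defining `lam2` is thus nonempty and
  -- finite, and its infimum is an eigenvalue.
  have expos : ∃ j, 0 < lam j := by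
    by_contra! hcon
    have hz : ∀ j, lam j = 0 := fun j => le_antisymm (hcon j) (nonneg j)
    have hN0 : 0 < N := by omega
    let j0 : Fin N := ⟨0, by omega⟩
    let j1 : Fin N := ⟨1, by omega⟩
    have hne : j0 ≠ j1 := by simp [j0, j1, Fin.ext_iff]
    have h01 : inner ℝ (b j0) (b j1) = 0 := b.orthonormal.2 hne
    have hval : ∀ j, ∀ i, b j i = b j j0 := fun j i => const j (hz j) i j0
    have h01' : ∑ i, b j1 i * b j0 i = 0 := by simpa [PiLp.inner_apply] using h01
    have n0 := normb j0
    have n1 := normb j1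
    simp only [hval] at h01' n0 n1
    simp only [Finset.sum_const, Finset.card_univ, Fintype.card_fin, nsmul_eq_mul] at h01' n0 n1
    have hNr : (0 : ℝ) < N := by exact_mod_cast hN0
    rcases mul_eq_zero.1 ((mul_eq_zero.1 h01').resolve_left hNr.ne') with h | h
    · rw [h] at n1; norm_num at n1
    · rw [h] at n0; norm_num at n0
  have hbdd : BddBelow {x ∈ spectrum ℝ G.laplacian | 0 < x} := ⟨0, fun x hx => hx.2.le⟩
  have hne : {x ∈ spectrum ℝ G.laplacian | 0 < x}.Nonempty := by
    obtain ⟨j, hj⟩ := expos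
    exact ⟨lam j, hspec ▸ mem_range_self j, hj⟩
  have hmem : G.lam2 ∈ {x ∈ spectrum ℝ G.laplacian | 0 < x} :=
    hne.csInf_mem (hfin.subset fun x hx => hx.1)
  have hle : ∀ x ∈ spectrum ℝ G.laplacian, x ≤ G.lamMax := fun x hx => le_csSup hfin.bddAbove hx
  refine ⟨hmem.2, hle _ hmem.1, fun j i => b j i, lam, ?_, action, ?_, ?_, const⟩
  · intro i k
    -- Completeness of the system is Parseval's identity for two standard basis vectors.
    have h := b.sum_inner_mul_inner (EuclideanSpace.single i 1) (EuclideanSpace.single k 1)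
    simpa [EuclideanSpace.inner_single_left, EuclideanSpace.inner_single_right,
      PiLp.single_apply, eq_comm] using h
  · intro j
    rcases (nonneg j).eq_or_lt with h | h
    · exact Or.inl h.symm
    · exact Or.inr (csInf_le hbdd ⟨hspec ▸ mem_range_self j, h⟩)
  · intro j
    exact hle _ (hspec ▸ mem_range_self j)

variable {G}
variable {E : Type*} [NormedAddCommGroup E] [InnerProductSpace ℝ E]

/-- The component of a family of vectors along the `j`-th mode. -/
def modeCoord (U : Fin N → Fin N → ℝ) (x : Fin N → E) (j : Fin N) : E := ∑ i, U j i • x i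

theorem modeCoord_add (U : Fin N → Fin N → ℝ) (x y : Fin N → E) (j : Fin N) :
    modeCoord U (fun i => x i + y i) j = modeCoord U x j + modeCoord U y j := by
  simp [modeCoord, smul_add, Finset.sum_add_distrib]

theorem modeCoord_smul (U : Fin N → Fin N → ℝ) (r : ℝ) (x : Fin N → E) (j : Fin N) :
    modeCoord U (fun i => r • x i) j = r • modeCoord U x j := by
  simp only [modeCoord, Finset.smul_sum]
  exact Finset.sum_congr rfl fun i _ => smul_comm _ _ _

/-- Parseval's identity for families with values in `E`: completeness collapses the triple sum to
its diagonal. -/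
theorem Modes.sum_inner_modeCoord {U : Fin N → Fin N → ℝ} {lam : Fin N → ℝ} (hU : Modes G U lam)
    (x y : Fin N → E) :
    ∑ j, inner ℝ (modeCoord U x j) (modeCoord U y j) = ∑ i, inner ℝ (x i) (y i) := by
  have h : ∀ i k, ∑ j, U j i * (U j k * inner ℝ (x i) (y k))
      = if i = k then inner ℝ (x i) (y k) else 0 := by
    intro i k
    simp only [← mul_assoc]
    rw [← Finset.sum_mul, hU.complete]
    split_ifs <;> simp
  calc ∑ j, inner ℝ (modeCoord U x j) (modeCoord U y j)
      = ∑ j, ∑ i, ∑ k, U j i * (U j k * inner ℝ (x i) (y k)) := by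
        refine Finset.sum_congr rfl fun j _ => ?_
        rw [modeCoord, modeCoord, sum_inner]
        refine Finset.sum_congr rfl fun i _ => ?_
        rw [inner_sum]
        exact Finset.sum_congr rfl fun k _ => by
          rw [real_inner_smul_left, real_inner_smul_right]
    _ = ∑ i, ∑ k, ∑ j, U j i * (U j k * inner ℝ (x i) (y k)) := by
        rw [Finset.sum_comm]
        exact Finset.sum_congr rfl fun i _ => Finset.sum_comm
    _ = ∑ i, inner ℝ (x i) (y i) := by
        simp only [h, Finset.sum_ite_eq, Finset.mem_univ, if_true]

theorem Modes.sum_norm_sq_modeCoord {U : Fin N → Fin N → ℝ} {lam : Fin N → ℝ}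
    (hU : Modes G U lam) (x : Fin N → E) :
    ∑ j, ‖modeCoord U x j‖ ^ 2 = ∑ i, ‖x i‖ ^ 2 := by
  simpa only [real_inner_self_eq_norm_sq] using hU.sum_inner_modeCoord x x

theorem Modes.modeCoord_lap {U : Fin N → Fin N → ℝ} {lam : Fin N → ℝ} (hU : Modes G U lam)
    (x : Fin N → E) (j : Fin N) : modeCoord U (G.lap x) j = lam j • modeCoord U x j := by
  have hs : ∀ i k, G.laplacian i k = G.laplacian k i := fun i k => by
    simpa using (congrFun (congrFun G.laplacian_isHermitian i) k).symm
  simp only [modeCoord, G.lap_eq, Finset.smul_sum, smul_smul]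
  rw [Finset.sum_comm]
  refine Finset.sum_congr rfl fun k _ => ?_
  rw [← Finset.sum_smul, ← hU.action j k, G.lap_eq]
  congr 1
  exact Finset.sum_congr rfl fun i _ => by rw [smul_eq_mul, hs k i, mul_comm]

/-- A kernel mode is constant, so its coordinate is a multiple of the sum. On families with zero sum
the Laplacian is therefore inverted by its pseudoinverse. -/
theorem Modes.modeCoord_eq_zero {U : Fin N → Fin N → ℝ} {lam : Fin N → ℝ} (hU : Modes G U lam)
    {x : Fin N → E} (hx : ∑ i, x i = 0) {j : Fin N} (hj : lam j = 0) : modeCoord U x j = 0 := by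
  have h : ∀ i, U j i • x i = U j j • x i := fun i => by rw [hU.const j hj i j]
  rw [modeCoord, Finset.sum_congr rfl fun i _ => h i, ← Finset.smul_sum, hx, smul_zero]

theorem Modes.sum_norm_sq_lap_le {U : Fin N → Fin N → ℝ} {lam : Fin N → ℝ} (hU : Modes G U lam)
    (h2 : 0 < G.lam2) (x : Fin N → E) :
    ∑ i, ‖G.lap x i‖ ^ 2 ≤ G.lamMax ^ 2 * ∑ i, ‖x i‖ ^ 2 := by
  rw [← hU.sum_norm_sq_modeCoord, ← hU.sum_norm_sq_modeCoord x, Finset.mul_sum]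
  refine Finset.sum_le_sum fun j _ => ?_
  rw [hU.modeCoord_lap, norm_smul, mul_pow, Real.norm_eq_abs, sq_abs]
  have h0 : 0 ≤ lam j := by rcases hU.gap j with h | h <;> linarith
  have := hU.upper j
  gcongr

end Spectral

/-! ### The optimal solution -/

section Optimum

variable {N n : ℕ} {f : Fin N → Vec n → ℝ}

theorem sum_gradient_eq_zero {ρc vc : ℝ} (hf : CostAssumption f ρc vc) {z : Vec n}
    (hz : IsMinOn (fun x => ∑ i, f i x) univ z) : ∑ i, gradient (f i) z = 0 := by
  have hd : HasFDerivAt (fun x => ∑ i, f i x) (∑ i, fderiv ℝ (f i) z) z :=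
    HasFDerivAt.fun_sum fun i _ => (hf.diff i z).hasFDerivAt
  have h0 := (hz.isLocalMin univ_mem).hasFDerivAt_eq_zero hd
  simp only [gradient]
  rw [← map_sum, h0, map_zero]

theorem exists_optimum (hN : 2 ≤ N) (hsolv : Solvable f) {ρc vc : ℝ}
    (hf : CostAssumption f ρc vc) :
    ∃ z : Vec n, optSet f = {fun _ => z} ∧ ∑ i, gradient (f i) z = 0 := by
  have i0 : Fin N := ⟨0, by omega⟩
  have hmin : ∀ y ∈ optSet f, IsMinOn (fun x => ∑ i, f i x) univ (y i0) := by
    intro y hy x _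
    have hy0 : y = fun _ => y i0 := funext fun i => hy.1 i i0
    have h1 : ∑ i, f i (y i0) = optValue f := by
      rw [← hy.2]
      exact Finset.sum_congr rfl fun i _ => by rw [hy.1 i i0]
    change ∑ i, f i (y i0) ≤ ∑ i, f i x
    rw [h1]
    exact csInf_le hsolv.finite_value ⟨fun _ => x, fun _ _ => rfl, rfl⟩
  obtain ⟨y, hy⟩ := hsolv.nonempty
  refine ⟨y i0, ?_, sum_gradient_eq_zero hf (hmin y hy)⟩
  apply Subset.antisymm
  · intro y' hy'
    have ha := sum_gradient_eq_zero hf (hmin y hy)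
    have hb := sum_gradient_eq_zero hf (hmin y' hy')
    -- Uniqueness: strong monotonicity is summed over the agents, and the gradient sums vanish at
    -- both minimizers.
    have hs : ∑ _i : Fin N, ρc * ‖y' i0 - y i0‖ ^ 2 ≤ 0 := by
      calc ∑ i : Fin N, ρc * ‖y' i0 - y i0‖ ^ 2
          ≤ ∑ i, inner ℝ (gradient (f i) (y' i0) - gradient (f i) (y i0)) (y' i0 - y i0) :=
            Finset.sum_le_sum fun i _ => hf.strong i _ _
        _ = 0 := by
            rw [← sum_inner, Finset.sum_sub_distrib, ha, hb, sub_zero, inner_zero_left]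
    rw [Finset.sum_const, Finset.card_univ, Fintype.card_fin, nsmul_eq_mul] at hs
    have hNr : (0 : ℝ) < N := by exact_mod_cast (by omega : 0 < N)
    have h0 : ‖y' i0 - y i0‖ ^ 2 ≤ 0 := by
      by_contra! h
      have := mul_pos hNr (mul_pos hf.ρc_pos h)
      linarith
    have h1 : y' i0 = y i0 := by
      rw [← sub_eq_zero, ← norm_eq_zero]
      exact pow_eq_zero_iff two_ne_zero |>.1 (le_antisymm h0 (sq_nonneg _))
    exact funext fun i => (hy'.1 i i0).trans h1
  · rintro _ rfl
    have hy0 : (fun _ => y i0) = y := funext fun i => hy.1 i0 i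
    rw [hy0]; exact hy

end Optimum

/-! ### The Lyapunov function of the optimization layer -/

section Reference

variable {N : ℕ} {G : WGraph N}
variable {E : Type*} [NormedAddCommGroup E] [InnerProductSpace ℝ E]

/-- The Lyapunov function `δ/2 (‖x‖² + wᵀ L⁺ w) + ‖x + w‖²/2`, where `L⁺` is the pseudoinverse of
the Laplacian. -/
noncomputable def lyapRef (δ : ℝ) (U : Fin N → Fin N → ℝ) (lam : Fin N → ℝ) (x w : Fin N → E) : ℝ :=
  δ / 2 * (∑ i, ‖x i‖ ^ 2 + ∑ j, (lam j)⁻¹ * ‖modeCoord U w j‖ ^ 2) + 1 / 2 * ∑ i, ‖x i + w i‖ ^ 2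

/-- The derivative of `lyapRef` at `(x, w)` in the direction `(x', w')`. -/
noncomputable def lyapRefDeriv (δ : ℝ) (U : Fin N → Fin N → ℝ) (lam : Fin N → ℝ)
    (x w x' w' : Fin N → E) : ℝ :=
  δ * (∑ i, inner ℝ (x i) (x' i)
      + ∑ j, (lam j)⁻¹ * inner ℝ (modeCoord U w j) (modeCoord U w' j))
    + ∑ i, inner ℝ (x i + w i) (x' i + w' i)

theorem hasDerivWithinAt_modeCoord {U : Fin N → Fin N → ℝ} {w : ℝ → Fin N → E} {w' : Fin N → E}
    {s : Set ℝ} {t : ℝ} (hw : ∀ i, HasDerivWithinAt (fun u => w u i) (w' i) s t) (j : Fin N) :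
    HasDerivWithinAt (fun u => modeCoord U (w u) j) (modeCoord U w' j) s t := by
  unfold modeCoord
  exact HasDerivWithinAt.fun_sum fun i _ => (hw i).const_smul (U j i)

theorem hasDerivWithinAt_lyapRef {δ : ℝ} {U : Fin N → Fin N → ℝ} {lam : Fin N → ℝ}
    {x w : ℝ → Fin N → E} {x' w' : Fin N → E} {s : Set ℝ} {t : ℝ}
    (hx : ∀ i, HasDerivWithinAt (fun u => x u i) (x' i) s t)
    (hw : ∀ i, HasDerivWithinAt (fun u => w u i) (w' i) s t) :
    HasDerivWithinAt (fun u => lyapRef δ U lam (x u) (w u))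
      (lyapRefDeriv δ U lam (x t) (w t) x' w') s t := by
  have h1 := HasDerivWithinAt.fun_sum (u := Finset.univ) fun i _ => (hx i).norm_sq
  have h2 := HasDerivWithinAt.fun_sum (u := Finset.univ) fun j _ =>
    ((hasDerivWithinAt_modeCoord (U := U) hw j).norm_sq).const_mul (lam j)⁻¹
  have h3 := HasDerivWithinAt.fun_sum (u := Finset.univ) fun i _ =>
    ((hx i).add (hw i)).norm_sq
  have h := ((h1.add h2).const_mul (δ / 2)).add (h3.const_mul (1 / 2))
  refine (h.congr_deriv ?_)
  simp only [lyapRefDeriv]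
  have e : ∀ j, (lam j)⁻¹ * (2 * inner ℝ (modeCoord U (w t) j) (modeCoord U w' j))
      = 2 * ((lam j)⁻¹ * inner ℝ (modeCoord U (w t) j) (modeCoord U w' j)) := fun j => by ring
  simp only [e, ← Finset.mul_sum, Pi.add_apply]
  ring

theorem lyapRefDeriv_smul (δ : ℝ) (U : Fin N → Fin N → ℝ) (lam : Fin N → ℝ)
    (x w x' w' : Fin N → E) (r : ℝ) :
    lyapRefDeriv δ U lam x w (fun i => r • x' i) (fun i => r • w' i)
      = r * lyapRefDeriv δ U lam x w x' w' := by
  have e : ∀ j, (lam j)⁻¹ * (r * inner ℝ (modeCoord U w j) (modeCoord U w' j))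
      = r * ((lam j)⁻¹ * inner ℝ (modeCoord U w j) (modeCoord U w' j)) := fun j => by ring
  simp only [lyapRefDeriv, modeCoord_smul, real_inner_smul_right, ← smul_add, e,
    ← Finset.mul_sum]
  ring

/-- The constant is `deltaUp + 1/2`: the estimate `‖x + w‖² ≤ 2 (‖x‖² + ‖w‖²)` costs `1` instead of
`1/2`. The formula for `c` leaves room for the excess. -/
theorem lyapRef_le {δ : ℝ} (hδ : 0 < δ) {U : Fin N → Fin N → ℝ} {lam : Fin N → ℝ}
    (hU : Modes G U lam) (h2 : 0 < G.lam2) {x w : Fin N → E} :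
    lyapRef δ U lam x w ≤ (δ * max 1 G.lam2⁻¹ / 2 + 1) * (∑ i, ‖x i‖ ^ 2 + ∑ i, ‖w i‖ ^ 2) := by
  have hm1 : (1 : ℝ) ≤ max 1 G.lam2⁻¹ := le_max_left _ _
  have hm2 : G.lam2⁻¹ ≤ max 1 G.lam2⁻¹ := le_max_right _ _
  set m := max 1 G.lam2⁻¹
  have hX : 0 ≤ ∑ i, ‖x i‖ ^ 2 := Finset.sum_nonneg fun i _ => sq_nonneg _
  have hW : ∑ j, (lam j)⁻¹ * ‖modeCoord U w j‖ ^ 2 ≤ m * ∑ i, ‖w i‖ ^ 2 := by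
    rw [← hU.sum_norm_sq_modeCoord w, Finset.mul_sum]
    refine Finset.sum_le_sum fun j _ => mul_le_mul_of_nonneg_right ?_ (sq_nonneg _)
    rcases hU.gap j with h | h
    -- In a kernel mode `0⁻¹ = 0` is exactly the value that the pseudoinverse requires.
    · rw [h, inv_zero]; linarith
    · exact (inv_anti₀ h2 h).trans hm2
  have hXW : ∑ i, ‖x i + w i‖ ^ 2 ≤ 2 * (∑ i, ‖x i‖ ^ 2 + ∑ i, ‖w i‖ ^ 2) := by
    rw [← Finset.sum_add_distrib, Finset.mul_sum]
    refine Finset.sum_le_sum fun i _ => ?_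
    have := norm_add_le (x i) (w i)
    nlinarith [sq_nonneg (‖x i‖ - ‖w i‖), norm_nonneg (x i + w i)]
  rw [lyapRef]
  have h1 := mul_le_mul_of_nonneg_left hW (half_pos hδ).le
  have h3 : δ / 2 * ∑ i, ‖x i‖ ^ 2 ≤ δ / 2 * (m * ∑ i, ‖x i‖ ^ 2) :=
    mul_le_mul_of_nonneg_left (by nlinarith) (half_pos hδ).le
  linarith

/-- The term `‖x + w‖²` is dropped, and the pseudoinverse does not see the kernel component of `w`;
the zero sum makes that component vanish. -/
theorem le_lyapRef {δ : ℝ} (hδ : 0 < δ) {U : Fin N → Fin N → ℝ} {lam : Fin N → ℝ}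
    (hU : Modes G U lam) (h2 : 0 < G.lam2) {x w : Fin N → E}
    (hw : ∑ i, w i = 0) :
    δ * min 1 G.lamMax⁻¹ / 2 * (∑ i, ‖x i‖ ^ 2 + ∑ i, ‖w i‖ ^ 2) ≤ lyapRef δ U lam x w := by
  have hm1 : min 1 G.lamMax⁻¹ ≤ (1 : ℝ) := min_le_left _ _
  have hm2 : min 1 G.lamMax⁻¹ ≤ G.lamMax⁻¹ := min_le_right _ _
  set m := min 1 G.lamMax⁻¹
  have hX : 0 ≤ ∑ i, ‖x i‖ ^ 2 := Finset.sum_nonneg fun i _ => sq_nonneg _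
  have hXW : 0 ≤ ∑ i, ‖x i + w i‖ ^ 2 := Finset.sum_nonneg fun i _ => sq_nonneg _
  have hW : m * ∑ i, ‖w i‖ ^ 2 ≤ ∑ j, (lam j)⁻¹ * ‖modeCoord U w j‖ ^ 2 := by
    rw [← hU.sum_norm_sq_modeCoord w, Finset.mul_sum]
    refine Finset.sum_le_sum fun j _ => ?_
    rcases hU.gap j with h | h
    · rw [hU.modeCoord_eq_zero hw h]; simp
    · exact mul_le_mul_of_nonneg_right
        (hm2.trans (inv_anti₀ (h2.trans_le h) (hU.upper j))) (sq_nonneg _)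
  rw [lyapRef]
  have h1 := mul_le_mul_of_nonneg_left hW (half_pos hδ).le
  have h3 : δ / 2 * (m * ∑ i, ‖x i‖ ^ 2) ≤ δ / 2 * ∑ i, ‖x i‖ ^ 2 :=
    mul_le_mul_of_nonneg_left (by nlinarith) (half_pos hδ).le
  linarith

/-- The part of the dissipation that is local to an agent; `h` is the gradient difference at the
reference, `H` the correction due to the gap `ξ`. Young's inequality spends half of the strong
convexity on `⟨x, H⟩` and `1/8 ‖w‖²` on each of three cross terms. The choice `δ ρ ≥ 4 v² + 1`
absorbs the resulting `2 v² ‖x‖²` and leaves `-1/2 ‖x‖²`. -/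
theorem node_dissipation {δ ρ v : ℝ} (hδ : 0 < δ) (hρ : 0 < ρ)
    (hδρ : 4 * v ^ 2 + 1 ≤ δ * ρ) {x w ξ h H : E}
    (h1 : ρ * ‖x‖ ^ 2 ≤ inner ℝ h x) (h2 : ‖h‖ ≤ v * ‖x‖) (h3 : ‖H‖ ≤ v * ‖ξ‖) :
    -(δ * inner ℝ x (h + H)) + δ * inner ℝ w ξ - inner ℝ (x + w) (h + H) - ‖w‖ ^ 2
      ≤ -(1 / 2) * ‖x‖ ^ 2 - 5 / 8 * ‖w‖ ^ 2
        + (v ^ 2 * δ / (2 * ρ) + 2 * δ ^ 2 + v ^ 2 / (2 * ρ) + 2 * v ^ 2) * ‖ξ‖ ^ 2 := by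
  rw [inner_add_left, inner_add_right, inner_add_right, real_inner_comm h x]
  have a1 : -inner ℝ x H ≤ ‖x‖ * (v * ‖ξ‖) := by
    have := (abs_le.1 (abs_real_inner_le_norm x H)).1
    have := mul_le_mul_of_nonneg_left h3 (norm_nonneg x)
    linarith
  have a2 : -inner ℝ w h ≤ ‖w‖ * (v * ‖x‖) := by
    have := (abs_le.1 (abs_real_inner_le_norm w h)).1
    have := mul_le_mul_of_nonneg_left h2 (norm_nonneg w)
    linarith
  have a3 : -inner ℝ w H ≤ ‖w‖ * (v * ‖ξ‖) := by
    have := (abs_le.1 (abs_real_inner_le_norm w H)).1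
    have := mul_le_mul_of_nonneg_left h3 (norm_nonneg w)
    linarith
  have a4 : inner ℝ w ξ ≤ ‖w‖ * ‖ξ‖ := real_inner_le_norm w ξ
  have b1 : ‖x‖ * (v * ‖ξ‖) ≤ ρ / 2 * ‖x‖ ^ 2 + v ^ 2 / (2 * ρ) * ‖ξ‖ ^ 2 := by
    have : ρ / 2 * ‖x‖ ^ 2 + v ^ 2 / (2 * ρ) * ‖ξ‖ ^ 2 - ‖x‖ * (v * ‖ξ‖)
        = (ρ * ‖x‖ - v * ‖ξ‖) ^ 2 / (2 * ρ) := by field_simp; ring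
    have : 0 ≤ (ρ * ‖x‖ - v * ‖ξ‖) ^ 2 / (2 * ρ) := by positivity
    linarith
  have b2 : ‖w‖ * (v * ‖x‖) ≤ 1 / 8 * ‖w‖ ^ 2 + 2 * v ^ 2 * ‖x‖ ^ 2 := by
    nlinarith [sq_nonneg (‖w‖ - 4 * (v * ‖x‖))]
  have b3 : ‖w‖ * (v * ‖ξ‖) ≤ 1 / 8 * ‖w‖ ^ 2 + 2 * v ^ 2 * ‖ξ‖ ^ 2 := by
    nlinarith [sq_nonneg (‖w‖ - 4 * (v * ‖ξ‖))]
  have b4 : δ * (‖w‖ * ‖ξ‖) ≤ 1 / 8 * ‖w‖ ^ 2 + 2 * δ ^ 2 * ‖ξ‖ ^ 2 := by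
    nlinarith [sq_nonneg (‖w‖ - 4 * (δ * ‖ξ‖))]
  have c1 := mul_le_mul_of_nonneg_left h1 (by linarith : 0 ≤ δ + 1)
  have c2 := mul_le_mul_of_nonneg_left (a1.trans b1) (by linarith : 0 ≤ δ + 1)
  have c4 := mul_le_mul_of_nonneg_left a4 hδ.le
  have c5 := mul_le_mul_of_nonneg_right hδρ (sq_nonneg ‖x‖)
  have c6 : 0 ≤ ρ * ‖x‖ ^ 2 := by positivity
  have e : v ^ 2 * δ / (2 * ρ) = δ * (v ^ 2 / (2 * ρ)) := by ring
  rw [e]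
  nlinarith

/-- The part that needs the Laplacian, one mode at a time. In a kernel mode `w = 0`; otherwise `δ l
≥ 4`, so half of `δ l ‖x‖²` pays for the `2 ‖x‖²` from `⟨x, w⟩` and the other half for the cross
term with `ξ`. -/
theorem mode_dissipation {δ l2 lN l : ℝ} (hδ : 0 < δ) (h2 : 0 < l2) (hδl : 4 ≤ δ * l2)
    (hgap : l = 0 ∨ l2 ≤ l) (hup : l ≤ lN) (hlN : l2 ≤ lN) {x w ξ : E} (hw : l = 0 → w = 0) :
    -(δ * (l * inner ℝ x (x + ξ))) - inner ℝ x w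
      ≤ δ * (lN ^ 2 / (2 * l2)) * ‖ξ‖ ^ 2 + 1 / 8 * ‖w‖ ^ 2 := by
  rcases hgap with h | h
  · rw [hw h, h]
    simp only [zero_mul, mul_zero, neg_zero, inner_zero_right, sub_zero, norm_zero]
    have hlN' : 0 < lN := h2.trans_le hlN
    have : 0 ≤ δ * (lN ^ 2 / (2 * l2)) * ‖ξ‖ ^ 2 := by positivity
    nlinarith
  · have hl : 0 < l := h2.trans_le h
    rw [inner_add_right, real_inner_self_eq_norm_sq]
    have a1 : -inner ℝ x ξ ≤ 1 / 2 * ‖x‖ ^ 2 + 1 / 2 * ‖ξ‖ ^ 2 := by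
      have := (abs_le.1 (abs_real_inner_le_norm x ξ)).1
      nlinarith [sq_nonneg (‖x‖ - ‖ξ‖)]
    have a2 : -inner ℝ x w ≤ 2 * ‖x‖ ^ 2 + 1 / 8 * ‖w‖ ^ 2 := by
      have := (abs_le.1 (abs_real_inner_le_norm x w)).1
      nlinarith [sq_nonneg (4 * ‖x‖ - ‖w‖)]
    have a3 : l / 2 ≤ lN ^ 2 / (2 * l2) := by
      rw [div_le_div_iff₀ two_pos (by positivity)]
      nlinarith [mul_le_mul hup hlN h2.le (hl.le.trans hup)]
    have b1 := mul_le_mul_of_nonneg_left a1 (mul_pos hδ hl).le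
    have b2 : δ * (l / 2) * ‖ξ‖ ^ 2 ≤ δ * (lN ^ 2 / (2 * l2)) * ‖ξ‖ ^ 2 := by gcongr
    have b3 : 4 * ‖x‖ ^ 2 ≤ δ * l * ‖x‖ ^ 2 :=
      mul_le_mul_of_nonneg_right (hδl.trans (by gcongr)) (sq_nonneg _)
    nlinarith

/-- Since `w` has zero sum, the pseudoinverse undoes the Laplacian in `w'`, and the resulting `δ c
⟨x, w⟩` cancels the one from `⟨x, x'⟩`. The square `‖x + w‖²/2` contributes `-c ‖w‖²` and `-c ⟨x,
w⟩`; the latter is moved to the modes, where the Laplacian dominates it. -/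
theorem lyapRefDeriv_eq {δ c k : ℝ} {U : Fin N → Fin N → ℝ} {lam : Fin N → ℝ}
    (hU : Modes G U lam) {x w ξ g ψ : Fin N → E} (hw : ∑ i, w i = 0)
    (hψ : ∀ i, ψ i = -(c • (g i + G.lap (fun i => x i + ξ i) i + w i))) :
    lyapRefDeriv δ U lam x w (fun i => k • x i + ψ i)
        (fun i => k • w i + c • G.lap (fun i => x i + ξ i) i)
      = 2 * k * lyapRef δ U lam x w
        + c * (∑ i, (-(δ * inner ℝ (x i) (g i)) + δ * inner ℝ (w i) (ξ i)
              - inner ℝ (x i + w i) (g i) - ‖w i‖ ^ 2)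
            + ∑ j, (-(δ * (lam j * inner ℝ (modeCoord U x j) (modeCoord U x j + modeCoord U ξ j)))
              - inner ℝ (modeCoord U x j) (modeCoord U w j))) := by
  set Y := G.lap (fun i => x i + ξ i) with hY
  have m1 : ∑ j, lam j * inner ℝ (modeCoord U x j) (modeCoord U x j + modeCoord U ξ j)
      = ∑ i, inner ℝ (x i) (Y i) := by
    rw [← hU.sum_inner_modeCoord]
    exact Finset.sum_congr rfl fun j _ => by
      rw [hU.modeCoord_lap, modeCoord_add, real_inner_smul_right]
  have m2 := hU.sum_inner_modeCoord x w
  have m3 : ∑ j, (lam j)⁻¹ * inner ℝ (modeCoord U w j)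
        (modeCoord U (fun i => k • w i + c • Y i) j)
      = k * ∑ j, (lam j)⁻¹ * ‖modeCoord U w j‖ ^ 2
        + c * ∑ i, (inner ℝ (x i) (w i) + inner ℝ (w i) (ξ i)) := by
    have e : ∀ i, inner ℝ (x i) (w i) + inner ℝ (w i) (ξ i) = inner ℝ (w i) (x i + ξ i) := by
      intro i; rw [inner_add_right, real_inner_comm]
    simp only [e]
    rw [← hU.sum_inner_modeCoord, Finset.mul_sum, Finset.mul_sum, ← Finset.sum_add_distrib]
    refine Finset.sum_congr rfl fun j _ => ?_
    rw [modeCoord_add, modeCoord_smul, modeCoord_smul, hU.modeCoord_lap, inner_add_right,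
      real_inner_smul_right, real_inner_smul_right, real_inner_smul_right,
      real_inner_self_eq_norm_sq]
    by_cases hj : lam j = 0
    · rw [hU.modeCoord_eq_zero hw hj]; simp
    · field_simp
  have m4 : ∀ i, inner ℝ (x i) (k • x i + ψ i) = k * ‖x i‖ ^ 2 - c * inner ℝ (x i) (g i)
      - c * inner ℝ (x i) (Y i) - c * inner ℝ (x i) (w i) := by
    intro i
    rw [hψ, inner_add_right, inner_neg_right, real_inner_smul_right, real_inner_smul_right,
      inner_add_right, inner_add_right, real_inner_self_eq_norm_sq]
    ring
  have m5 : ∀ i, inner ℝ (x i + w i) (k • x i + ψ i + (k • w i + c • Y i))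
      = k * ‖x i + w i‖ ^ 2 - c * inner ℝ (x i + w i) (g i) - c * inner ℝ (x i) (w i)
        - c * ‖w i‖ ^ 2 := by
    intro i
    -- The Laplacian terms of `x'` and `w'` cancel in the sum, which is why `x + w` occurs in the
    -- Lyapunov function.
    have e : k • x i + ψ i + (k • w i + c • Y i) = k • (x i + w i) - c • (g i + w i) := by
      rw [hψ]; module
    rw [e, inner_sub_right, real_inner_smul_right, real_inner_smul_right,
      inner_add_right (x i + w i) (g i), inner_add_left (x i) (w i) (w i),
      real_inner_self_eq_norm_sq, real_inner_self_eq_norm_sq]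
    ring
  simp only [lyapRefDeriv, lyapRef]
  rw [m3]
  simp only [m4, m5, Finset.sum_add_distrib, Finset.sum_sub_distrib, Finset.sum_neg_distrib,
    ← Finset.mul_sum, m1, m2]
  ring

/-- Dissipation inequality for the optimization layer. -/
theorem lyapRefDeriv_le {δ ρ v c k k' : ℝ} (hδ : 0 < δ) (hρ : 0 < ρ) (hc : 0 < c)
    (hk : 0 ≤ k) (hkk : k ≤ k')
    {U : Fin N → Fin N → ℝ} {lam : Fin N → ℝ} (hU : Modes G U lam)
    (h2 : 0 < G.lam2) (h2N : G.lam2 ≤ G.lamMax)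
    (hδρ : 4 * v ^ 2 + 1 ≤ δ * ρ) (hδl : 4 ≤ δ * G.lam2)
    {x w ξ g h ψ : Fin N → E} (hw : ∑ i, w i = 0)
    (hψ : ∀ i, ψ i = -(c • (g i + G.lap (fun i => x i + ξ i) i + w i)))
    (h1 : ∀ i, ρ * ‖x i‖ ^ 2 ≤ inner ℝ (h i) (x i)) (hh : ∀ i, ‖h i‖ ≤ v * ‖x i‖)
    (hgh : ∀ i, ‖g i - h i‖ ≤ v * ‖ξ i‖) :
    lyapRefDeriv δ U lam x w (fun i => k • x i + ψ i)
        (fun i => k • w i + c • G.lap (fun i => x i + ξ i) i)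
      ≤ (2 * k' * (δ * max 1 G.lam2⁻¹ / 2 + 1) - c / 2)
          * (∑ i, ‖x i‖ ^ 2 + ∑ i, ‖w i‖ ^ 2)
        + c * (v ^ 2 * δ / (2 * ρ) + G.lamMax ^ 2 * δ / (2 * G.lam2) + 2 * δ ^ 2
          + v ^ 2 / (2 * ρ) + 2 * v ^ 2) * ∑ i, ‖ξ i‖ ^ 2 := by
  rw [lyapRefDeriv_eq hU hw hψ]
  have n1 : ∑ i, (-(δ * inner ℝ (x i) (g i)) + δ * inner ℝ (w i) (ξ i)
              - inner ℝ (x i + w i) (g i) - ‖w i‖ ^ 2)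
      ≤ ∑ i, (-(1 / 2) * ‖x i‖ ^ 2 - 5 / 8 * ‖w i‖ ^ 2
        + (v ^ 2 * δ / (2 * ρ) + 2 * δ ^ 2 + v ^ 2 / (2 * ρ) + 2 * v ^ 2) * ‖ξ i‖ ^ 2) := by
    refine Finset.sum_le_sum fun i _ => ?_
    have := node_dissipation (x := x i) (w := w i) (ξ := ξ i) hδ hρ hδρ (h1 i) (hh i) (hgh i)
    rwa [add_sub_cancel] at this
  have n2 := Finset.sum_le_sum fun j (_ : j ∈ Finset.univ) =>
    mode_dissipation (x := modeCoord U x j) (w := modeCoord U w j) (ξ := modeCoord U ξ j)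
      hδ h2 hδl (hU.gap j) (hU.upper j) h2N (hU.modeCoord_eq_zero hw)
  simp only [Finset.sum_add_distrib (f := fun j => δ * (G.lamMax ^ 2 / (2 * G.lam2))
    * ‖modeCoord U ξ j‖ ^ 2), ← Finset.mul_sum, hU.sum_norm_sq_modeCoord] at n2
  simp only [Finset.sum_add_distrib (f := fun i => -(1 / 2) * ‖x i‖ ^ 2 - 5 / 8 * ‖w i‖ ^ 2),
    Finset.sum_sub_distrib (f := fun i => -(1 / 2) * ‖x i‖ ^ 2), ← Finset.mul_sum] at n1
  -- The coefficient of `‖w‖²` is `-5/8` from the nodes and `1/8` from the modes, together `-1/2`,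
  -- the same as for `‖x‖²`.
  have n3 := mul_le_mul_of_nonneg_left (add_le_add n1 n2) hc.le
  have l1 := lyapRef_le (x := x) (w := w) hδ hU h2
  have hX : 0 ≤ ∑ i, ‖x i‖ ^ 2 := Finset.sum_nonneg fun i _ => sq_nonneg _
  have hW : 0 ≤ ∑ i, ‖w i‖ ^ 2 := Finset.sum_nonneg fun i _ => sq_nonneg _
  have hB : 0 ≤ (δ * max 1 G.lam2⁻¹ / 2 + 1) * (∑ i, ‖x i‖ ^ 2 + ∑ i, ‖w i‖ ^ 2) := by
    have : 0 ≤ max 1 G.lam2⁻¹ := zero_le_one.trans (le_max_left _ _)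
    positivity
  have l2 : k * lyapRef δ U lam x w
      ≤ k' * ((δ * max 1 G.lam2⁻¹ / 2 + 1) * (∑ i, ‖x i‖ ^ 2 + ∑ i, ‖w i‖ ^ 2)) :=
    (mul_le_mul_of_nonneg_left l1 hk).trans (mul_le_mul_of_nonneg_right hkk hB)
  have e : G.lamMax ^ 2 * δ / (2 * G.lam2) = δ * (G.lamMax ^ 2 / (2 * G.lam2)) := by ring
  rw [e]
  nlinarith

/-- Cauchy–Schwarz with weights `v`, `λ_N` and `1`: `(v a + l b + d)² ≤ (v + l + 1)(v a² + l b² +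
d²)`. The Laplacian term is normalized by `λ_N` and then bounded by the spectral norm. -/
theorem sum_norm_sq_reference_le {v c : ℝ} (hv : 0 < v)
    {U : Fin N → Fin N → ℝ} {lam : Fin N → ℝ} (hU : Modes G U lam)
    (h2 : 0 < G.lam2) (h2N : G.lam2 ≤ G.lamMax) {x w ξ g ψ : Fin N → E}
    (hψ : ∀ i, ψ i = -(c • (g i + G.lap (fun i => x i + ξ i) i + w i)))
    (hg : ∀ i, ‖g i‖ ≤ v * ‖x i + ξ i‖) :
    ∑ i, ‖ψ i‖ ^ 2 ≤ 2 * c ^ 2 * (v + G.lamMax + 1) ^ 2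
      * (∑ i, ‖x i‖ ^ 2 + ∑ i, ‖w i‖ ^ 2 + ∑ i, ‖ξ i‖ ^ 2) := by
  set Y := G.lap (fun i => x i + ξ i) with hY
  have hl : 0 < G.lamMax := h2.trans_le h2N
  set l := G.lamMax with hldef
  have hb : ∑ i, ‖Y i‖ ^ 2 ≤ l ^ 2 * ∑ i, ‖x i + ξ i‖ ^ 2 := hU.sum_norm_sq_lap_le h2 _
  have hA : ∑ i, ‖x i + ξ i‖ ^ 2 ≤ 2 * (∑ i, ‖x i‖ ^ 2 + ∑ i, ‖ξ i‖ ^ 2) := by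
    rw [← Finset.sum_add_distrib, Finset.mul_sum]
    refine Finset.sum_le_sum fun i _ => ?_
    have := norm_add_le (x i) (ξ i)
    nlinarith [sq_nonneg (‖x i‖ - ‖ξ i‖), norm_nonneg (x i + ξ i)]
  have hi : ∀ i, ‖ψ i‖ ^ 2 ≤ c ^ 2 * ((v + l + 1) * (v * ‖x i + ξ i‖ ^ 2 + l⁻¹ * ‖Y i‖ ^ 2
      + ‖w i‖ ^ 2)) := by
    intro i
    rw [hψ, norm_neg, norm_smul, mul_pow, Real.norm_eq_abs, sq_abs]
    refine mul_le_mul_of_nonneg_left ?_ (sq_nonneg c)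
    have h1 : ‖g i + Y i + w i‖ ≤ v * ‖x i + ξ i‖ + ‖Y i‖ + ‖w i‖ :=
      (norm_add₃_le).trans (by linarith [hg i])
    refine (pow_le_pow_left₀ (norm_nonneg _) h1 2).trans ?_
    have hY : ‖Y i‖ = l * (l⁻¹ * ‖Y i‖) := by field_simp
    have hY2 : l⁻¹ * ‖Y i‖ ^ 2 = l * (l⁻¹ * ‖Y i‖) ^ 2 := by field_simp
    rw [hY2]
    set b := l⁻¹ * ‖Y i‖
    rw [hY]
    set a := ‖x i + ξ i‖
    set d := ‖w i‖
    nlinarith [mul_nonneg (mul_pos hv hl).le (sq_nonneg (a - b)),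
      mul_nonneg hv.le (sq_nonneg (a - d)), mul_nonneg hl.le (sq_nonneg (b - d))]
  have hs := Finset.sum_le_sum fun i (_ : i ∈ Finset.univ) => hi i
  simp only [← Finset.mul_sum, Finset.sum_add_distrib] at hs
  refine hs.trans ?_
  have hX : 0 ≤ ∑ i, ‖x i‖ ^ 2 := Finset.sum_nonneg fun i _ => sq_nonneg _
  have hW : 0 ≤ ∑ i, ‖w i‖ ^ 2 := Finset.sum_nonneg fun i _ => sq_nonneg _
  have hZ : 0 ≤ ∑ i, ‖ξ i‖ ^ 2 := Finset.sum_nonneg fun i _ => sq_nonneg _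
  have hb' : l⁻¹ * ∑ i, ‖Y i‖ ^ 2 ≤ l * ∑ i, ‖x i + ξ i‖ ^ 2 := by
    have := mul_le_mul_of_nonneg_left hb (inv_pos.2 hl).le
    have e : l⁻¹ * (l ^ 2 * ∑ i, ‖x i + ξ i‖ ^ 2) = l * ∑ i, ‖x i + ξ i‖ ^ 2 := by field_simp
    linarith
  have h3 : v * ∑ i, ‖x i + ξ i‖ ^ 2 + l⁻¹ * ∑ i, ‖Y i‖ ^ 2 + ∑ i, ‖w i‖ ^ 2
      ≤ (v + l + 1) * (2 * (∑ i, ‖x i‖ ^ 2 + ∑ i, ‖w i‖ ^ 2 + ∑ i, ‖ξ i‖ ^ 2)) := by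
    have := mul_le_mul_of_nonneg_left hA (by positivity : 0 ≤ v + l)
    nlinarith [mul_nonneg (by positivity : 0 ≤ v + l) hW]
  have hpos : 0 ≤ c ^ 2 * (v + l + 1) := by positivity
  have := mul_le_mul_of_nonneg_left h3 hpos
  linarith

end Reference

/-! ### The time-varying gain -/

section Gain

variable {t0 T bt : ℝ} {μ : ℝ → ℝ}

theorem ClassKT.rate_nonneg (h : ClassKT t0 T bt μ) (t : ℝ) : 0 ≤ rate t0 T μ t :=
  h.strictMono.monotoneOn.derivWithin_nonneg

/-- If `μ(t₀)` were `0`, the bound `μ' ≤ b̃ μ²` would contradict `μ'(t₀) > 0`. -/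
theorem ClassKT.init_pos (h : ClassKT t0 T bt μ) (hT : 0 < T) : 0 < μ t0 := by
  have hmem : t0 ∈ Tp t0 T := ⟨le_rfl, by linarith⟩
  obtain ⟨b, hb, hbμ⟩ := h.range_bound
  have h0 : 0 ≤ μ t0 := hb.trans (hbμ t0 hmem)
  refine h0.lt_of_ne fun he => ?_
  have h1 := h.rate_le t0 hmem
  rw [← he, zero_pow two_ne_zero, mul_zero] at h1
  exact h.rate_init.not_ge h1

theorem ClassKT.init_le (h : ClassKT t0 T bt μ) {t : ℝ} (ht : t ∈ Tp t0 T) :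
    μ t0 ≤ μ t :=
  h.strictMono.monotoneOn ⟨le_rfl, ht.1.trans_lt ht.2⟩ ht ht.1

theorem ClassKT.pos (h : ClassKT t0 T bt μ) {t : ℝ} (ht : t ∈ Tp t0 T) :
    0 < μ t :=
  (h.init_pos (by linarith [ht.1.trans_lt ht.2])).trans_le (h.init_le ht)

/-- Passes to the set `Ici t0`, relative to which the closed-loop equations are stated; near a time
before `T + t₀` the two sets coincide. -/
theorem ClassKT.hasDerivWithinAt (h : ClassKT t0 T bt μ) {t : ℝ} (ht : t ∈ Tp t0 T) :
    HasDerivWithinAt μ (rate t0 T μ t) (Ici t0) t := by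
  have h1 : HasDerivWithinAt μ (rate t0 T μ t) (Tp t0 T) t :=
    ((h.contDiff.differentiableOn one_ne_zero) t ht).hasDerivWithinAt
  refine h1.mono_of_mem_nhdsWithin ?_
  rw [Tp, ← Ici_inter_Iio]
  exact inter_mem_nhdsWithin _ (Iio_mem_nhds ht.2)

theorem ClassKT.hasDerivWithinAt_rpow (h : ClassKT t0 T bt μ) (p : ℝ) {t : ℝ}
    (ht : t ∈ Tp t0 T) :
    HasDerivWithinAt (fun s => μ s ^ p) (p * (rate t0 T μ t / μ t) * μ t ^ p) (Ici t0) t := by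
  refine ((h.hasDerivWithinAt ht).rpow_const (Or.inl (h.pos ht).ne')).congr_deriv ?_
  rw [Real.rpow_sub_one (h.pos ht).ne']
  ring

end Gain

/-! ### Inertia matrices -/

section Inertia

variable {n p : ℕ} {P : Plant n p} {kl ku : ℝ}

theorem Plant.InertiaProperty.symm (h : P.InertiaProperty kl ku) (q x y : Vec n) :
    inner ℝ x (P.M q y) = inner ℝ (P.M q x) y := by
  have h1 := ((ContinuousLinearMap.le_def _ _).1 (h.lower q)).isSymmetric x y
  simp only [ContinuousLinearMap.coe_coe, sub_apply,
    smul_apply, one_apply_eq_self, inner_sub_left, inner_sub_right,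
    real_inner_smul_left, real_inner_smul_right] at h1
  linarith

theorem Plant.InertiaProperty.le_inner (h : P.InertiaProperty kl ku) (q x : Vec n) :
    kl * ‖x‖ ^ 2 ≤ inner ℝ x (P.M q x) := by
  have h1 := ((ContinuousLinearMap.le_def _ _).1 (h.lower q)).inner_nonneg_right x
  simp only [sub_apply, smul_apply,
    one_apply_eq_self, inner_sub_right, real_inner_smul_right,
    real_inner_self_eq_norm_sq] at h1
  linarith

theorem Plant.InertiaProperty.inner_le (h : P.InertiaProperty kl ku) (q x : Vec n) :
    inner ℝ x (P.M q x) ≤ ku * ‖x‖ ^ 2 := by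
  have h1 := ((ContinuousLinearMap.le_def _ _).1 (h.upper q)).inner_nonneg_right x
  simp only [sub_apply, smul_apply,
    one_apply_eq_self, inner_sub_right, real_inner_smul_right,
    real_inner_self_eq_norm_sq] at h1
  linarith

/-- Young's inequality for the inertia form. -/
theorem Plant.InertiaProperty.neg_inner_le (h : P.InertiaProperty kl ku) (q s y : Vec n) (k : ℝ) :
    -(k * inner ℝ s (P.M q y)) ≤ 1 / 2 * k ^ 2 * ku ^ 2 * ‖s‖ ^ 2 + 1 / 2 * ‖y‖ ^ 2 := by
  -- Positivity of the inertia form at `k ku s + y`, combined with its upper bound at `s` and at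
  -- `y`, is `2 ku` times the claim.
  have h0 : 0 ≤ inner ℝ ((k * ku) • s + y) (P.M q ((k * ku) • s + y)) :=
    (mul_nonneg h.kl_pos.le (sq_nonneg _)).trans (h.le_inner q _)
  have hs : inner ℝ y (P.M q s) = inner ℝ s (P.M q y) := by
    rw [h.symm, real_inner_comm]
  simp only [map_add, map_smul, inner_add_left, inner_add_right, real_inner_smul_left,
    real_inner_smul_right, hs] at h0
  have h1 := mul_le_mul_of_nonneg_left (h.inner_le q s) (sq_nonneg (k * ku))
  have h2 := h.inner_le q y
  have h3 : 0 ≤ ku * (1 / 2 * k ^ 2 * ku ^ 2 * ‖s‖ ^ 2 + 1 / 2 * ‖y‖ ^ 2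
      + k * inner ℝ s (P.M q y)) := by nlinarith
  have := nonneg_of_mul_nonneg_right h3 h.ku_pos
  linarith

/-- Along a motion, the derivative of the energy form `⟨s, M s⟩/2` is `⟨s, M s' + C s⟩`. -/
theorem hasDerivWithinAt_energy (hP : P.SkewProperty) (hM : P.InertiaProperty kl ku)
    {q s : ℝ → Vec n} {dq s' : Vec n} {A : Set ℝ} {t : ℝ}
    (hq : HasDerivWithinAt q dq A t) (hs : HasDerivWithinAt s s' A t) :
    HasDerivWithinAt (fun u => 1 / 2 * inner ℝ (s u) (P.M (q u) (s u)))
      (inner ℝ (s t) (P.M (q t) s' + P.C (q t) dq (s t))) A t := by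
  have hMq : HasDerivWithinAt (fun u => P.M (q u)) (fderiv ℝ P.M (q t) dq) A t :=
    (hP.diff (q t)).hasFDerivAt.comp_hasDerivWithinAt t hq
  have h := (hs.inner ℝ (hMq.clm_apply hs)).const_mul (1 / 2)
  refine h.congr_deriv ?_
  -- The quadratic form of the skew map `M' - 2C` vanishes, so half the derivative of `M` acts on
  -- `s` as `C` does.
  have hsk : inner ℝ (s t) ((fderiv ℝ P.M (q t) dq) (s t))
      = 2 * inner ℝ (s t) (P.C (q t) dq (s t)) := by
    set A := fderiv ℝ P.M (q t) dq - (2 : ℝ) • P.C (q t) dq with hA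
    have h1 : inner ℝ (s t) (A (s t)) = inner ℝ (ContinuousLinearMap.adjoint A (s t)) (s t) :=
      (ContinuousLinearMap.adjoint_inner_left A (s t) (s t)).symm
    rw [hP.skew, ← hA, neg_apply, inner_neg_left,
      real_inner_comm (s t) (A (s t))] at h1
    have h2 : inner ℝ (s t) (A (s t)) = 0 := by linarith
    rw [hA, sub_apply, smul_apply, inner_sub_right,
      real_inner_smul_right] at h2
    linarith
  rw [inner_add_right, inner_add_right, hsk, real_inner_comm (P.M (q t) (s t)) s',
    ← hM.symm (q t) (s t) s']
  ring

end Inertia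

/-- Dissipation inequality for one agent of the tracking layer. -/
theorem tracking_dissipation {n p : ℕ} {P : Plant n p} {kl ku : ℝ}
    (hM : P.InertiaProperty kl ku) {k kι k1 k2 k1s k2s σ : ℝ} (hk : k ≤ kι)
    (hk1 : k1 = k1s + kι + 1) (hk2 : k2 = k2s + (1 / 2) * k1 ^ 2 * ku ^ 2 + 1 / 2)
    (hσ : 0 ≤ σ) (q ξ s ψ : Vec n) (θ' θ : Vec p) :
    inner ℝ ξ (s - (k1 - k) • ξ - ψ) + (-(k2 * ‖s‖ ^ 2) - k1 * inner ℝ s (P.M q ψ))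
        + 1 / 2 * σ * inner ℝ θ' (θ - θ')
      ≤ -(k2s * ‖s‖ ^ 2) - k1s * ‖ξ‖ ^ 2 + ‖ψ‖ ^ 2 - 1 / 4 * σ * ‖θ'‖ ^ 2
        + 1 / 4 * σ * ‖θ‖ ^ 2 := by
  -- How the gains are spent: `kι` covers the growth, the summand `1` of `k1` two halves of `‖ξ‖²`,
  -- the term `k1² ku²/2` the coupling through `M ψ`, and the `1/2` in `k2` the product of `ξ` and
  -- `s`. The two halves of `‖ψ‖²` add up to coefficient `1`.
  have h1 := hM.neg_inner_le q s ψ k1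
  rw [inner_sub_right, inner_sub_right, inner_sub_right, real_inner_smul_right,
    real_inner_self_eq_norm_sq, real_inner_self_eq_norm_sq]
  have h2 : inner ℝ ξ s ≤ 1 / 2 * ‖ξ‖ ^ 2 + 1 / 2 * ‖s‖ ^ 2 := by
    have := real_inner_le_norm ξ s
    nlinarith [sq_nonneg (‖ξ‖ - ‖s‖)]
  have h3 : -inner ℝ ξ ψ ≤ 1 / 2 * ‖ξ‖ ^ 2 + 1 / 2 * ‖ψ‖ ^ 2 := by
    have := (abs_le.1 (abs_real_inner_le_norm ξ ψ)).1
    nlinarith [sq_nonneg (‖ξ‖ - ‖ψ‖)]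
  have h4 : inner ℝ θ' θ ≤ 1 / 2 * ‖θ'‖ ^ 2 + 1 / 2 * ‖θ‖ ^ 2 := by
    have := real_inner_le_norm θ' θ
    nlinarith [sq_nonneg (‖θ'‖ - ‖θ‖)]
  have h5 := mul_le_mul_of_nonneg_left h4 hσ
  have h6 := mul_le_mul_of_nonneg_right hk (sq_nonneg ‖ξ‖)
  rw [hk2]
  have h7 : k1 * ‖ξ‖ ^ 2 = k1s * ‖ξ‖ ^ 2 + kι * ‖ξ‖ ^ 2 + ‖ξ‖ ^ 2 := by rw [hk1]; ring
  linarith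

/-! ### Scaled signals of the closed loop -/

section Scaled

variable {N n p : ℕ} (L : Loop N n p) (S : Signals N n p) (z : Vec n)

/-- `μ^ι (ϖ - z)`. -/
noncomputable def scaledRef (t : ℝ) (i : Fin N) : Vec n := L.μ t ^ L.η.ι • (S.ϖ t i - z)

/-- `μ^ι (v + ∇f(z))`. -/
noncomputable def scaledInt (t : ℝ) (i : Fin N) : Vec n :=
  L.μ t ^ L.η.ι • (S.v t i + gradient (L.f i) z)

/-- `μ^ι (y - ϖ)`. -/
noncomputable def scaledGap (t : ℝ) (i : Fin N) : Vec n := L.μ t ^ L.η.ι • (S.q t i - S.ϖ t i)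

/-- `μ^(ι-1) s`. -/
noncomputable def scaledSlide (t : ℝ) (i : Fin N) : Vec n :=
  L.μ t ^ (L.η.ι - 1) • (S.dq t i + (L.η.k1 i * L.μ t) • (S.q t i - S.ϖ t i))

/-- `μ^ι (∇f(y) - ∇f(z))`. -/
noncomputable def scaledGrad (t : ℝ) (i : Fin N) : Vec n :=
  L.μ t ^ L.η.ι • (gradient (L.f i) (S.q t i) - gradient (L.f i) z)

/-- `μ^(ι-1) ϖ'`. -/
noncomputable def scaledRefVel (t : ℝ) (i : Fin N) : Vec n :=
  -(L.η.c • (scaledGrad L S z t i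
    + L.G.lap (fun j => scaledRef L S z t j + scaledGap L S t j) i + scaledInt L S z t i))

/-- The growth rate `ι μ' / μ²` of `μ^ι`, relative to `μ`. -/
noncomputable def growth (t : ℝ) : ℝ := L.η.ι * (rate L.t0 L.T L.μ t / L.μ t ^ 2)

variable {L S}

theorem smul_lap_eq (t : ℝ) (i : Fin N) :
    L.G.lap (fun j => scaledRef L S z t j + scaledGap L S t j) i
      = L.μ t ^ L.η.ι • relInfo L S t i := by
  simp only [WGraph.lap, relInfo, Finset.smul_sum, Signals.y]
  refine Finset.sum_congr rfl fun j _ => ?_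
  simp only [scaledRef, scaledGap]
  module

theorem smul_refVel_eq (t : ℝ) (i : Fin N) :
    scaledRefVel L S z t i = -((L.η.c * L.μ t ^ L.η.ι) •
      (gradient (L.f i) (S.y t i) + relInfo L S t i + S.v t i)) := by
  rw [scaledRefVel, smul_lap_eq, scaledGrad, scaledInt, Signals.y]
  module

variable {bt : ℝ} {tEnd : EReal}

theorem gain_eq_mul (hμ : ClassKT L.t0 L.T bt L.μ) {t : ℝ} (ht : t ∈ Tp L.t0 L.T) :
    L.μ t ^ L.η.ι = L.μ t * L.μ t ^ (L.η.ι - 1) := by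
  rw [Real.rpow_sub_one (hμ.pos ht).ne', mul_div_cancel₀ _ (hμ.pos ht).ne']

theorem hasDerivWithinAt_scaledRef (hμ : ClassKT L.t0 L.T bt L.μ) (hS : IsSolution L S tEnd)
    {t : ℝ} (ht : t ∈ timeDom L.t0 tEnd) (htT : t < L.T + L.t0) (i : Fin N) :
    HasDerivWithinAt (fun u => scaledRef L S z u i)
      (L.μ t • (growth L t • scaledRef L S z t i + scaledRefVel L S z t i)) (Ici L.t0) t := by
  have hm := hμ.hasDerivWithinAt_rpow L.η.ι ⟨ht.1, htT⟩
  refine (hm.smul ((hS.ϖ_eq t ht htT i).sub_const z)).congr_deriv ?_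
  have hpos := (hμ.pos ⟨ht.1, htT⟩).ne'
  rw [smul_refVel_eq, growth, scaledRef]
  match_scalars <;> field_simp

theorem hasDerivWithinAt_scaledInt (hμ : ClassKT L.t0 L.T bt L.μ) (hS : IsSolution L S tEnd)
    {t : ℝ} (ht : t ∈ timeDom L.t0 tEnd) (htT : t < L.T + L.t0) (i : Fin N) :
    HasDerivWithinAt (fun u => scaledInt L S z u i)
      (L.μ t • (growth L t • scaledInt L S z t i
        + L.η.c • L.G.lap (fun j => scaledRef L S z t j + scaledGap L S t j) i)) (Ici L.t0) t := by
  have hm := hμ.hasDerivWithinAt_rpow L.η.ι ⟨ht.1, htT⟩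
  refine (hm.smul ((hS.v_eq t ht htT i).add_const (gradient (L.f i) z))).congr_deriv ?_
  have hpos := (hμ.pos ⟨ht.1, htT⟩).ne'
  rw [smul_lap_eq, growth, scaledInt]
  match_scalars <;> field_simp

theorem hasDerivWithinAt_scaledGap (hμ : ClassKT L.t0 L.T bt L.μ) (hS : IsSolution L S tEnd)
    {t : ℝ} (ht : t ∈ timeDom L.t0 tEnd) (htT : t < L.T + L.t0) (i : Fin N) :
    HasDerivWithinAt (fun u => scaledGap L S u i)
      (L.μ t • (scaledSlide L S t i - (L.η.k1 i - growth L t) • scaledGap L S t i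
        - scaledRefVel L S z t i)) (Ici L.t0) t := by
  have hm := hμ.hasDerivWithinAt_rpow L.η.ι ⟨ht.1, htT⟩
  refine (hm.fun_smul ((hS.pos_eq t ht i).fun_sub (hS.ϖ_eq t ht htT i))).congr_deriv ?_
  have hpos := (hμ.pos ⟨ht.1, htT⟩).ne'
  rw [smul_refVel_eq, growth, scaledGap, scaledSlide, gain_eq_mul hμ ⟨ht.1, htT⟩]
  match_scalars <;> field_simp <;> ring

/-- The error dynamics of the sliding variable. -/
theorem slide_dynamics (hμ : ClassKT L.t0 L.T bt L.μ) (hS : IsSolution L S tEnd)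
    {ρ : Fin N → ℝ} (hΩ : ∀ i, (L.plant i).RegressionProperty (ρ i))
    {t : ℝ} (ht : t ∈ timeDom L.t0 tEnd) (htT : t < L.T + L.t0) (i : Fin N) :
    ∃ s' : Vec n, HasDerivWithinAt (fun u => scaledSlide L S u i) s' (Ici L.t0) t ∧
      (L.plant i).M (S.q t i) s' + (L.plant i).C (S.q t i) (S.dq t i) (scaledSlide L S t i)
        = L.μ t • (-(L.η.k2 i • scaledSlide L S t i)
            - L.η.k1 i • (L.plant i).M (S.q t i) (scaledRefVel L S z t i))
          + L.μ t ^ (L.η.ι - 1) • regr L S t i ((L.plant i).θ - S.θhat t i) := by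
  have htp : t ∈ Tp L.t0 L.T := ⟨ht.1, htT⟩
  have hpos := (hμ.pos htp).ne'
  have hm := hμ.hasDerivWithinAt_rpow (L.η.ι - 1) htp
  have hk := (hμ.hasDerivWithinAt htp).const_mul (L.η.k1 i)
  have hd := hm.fun_smul ((hS.vel_eq t ht htT i).fun_add
    (hk.fun_smul ((hS.pos_eq t ht i).fun_sub (hS.ϖ_eq t ht htT i))))
  set ϖ' := -((L.η.c * L.μ t) • (gradient (L.f i) (S.y t i) + relInfo L S t i + S.v t i)) with hϖ'
  have hψ : scaledRefVel L S z t i = L.μ t ^ (L.η.ι - 1) • ϖ' := by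
    rw [smul_refVel_eq, hϖ', gain_eq_mul hμ htp]
    module
  -- The variable `z₁` collects all terms of the derivative except the acceleration and the
  -- reference velocity: the growth of `μ^(ι-1)`, the derivative of the gain `k₁ μ`, and `k₁ μ q'`.
  refine ⟨L.μ t ^ (L.η.ι - 1) • (S.ddq t i + z1 L S t i - (L.η.k1 i * L.μ t) • ϖ'),
    hd.congr_deriv ?_, ?_⟩
  · simp only [z1, muTilde, Signals.y]
    match_scalars <;> field_simp <;> ring
  · have e1 := hS.euler_lagrange t ht i
    have e2 := (hΩ i).param (S.q t i) (S.dq t i) (z1 L S t i) (z2 L S t i)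
    have e3 : scaledSlide L S t i = L.μ t ^ (L.η.ι - 1) • (S.dq t i + z2 L S t i) := rfl
    have e4 : τ L S t i = -((L.η.k2 i * L.μ t) • (S.dq t i + z2 L S t i))
        - regr L S t i (S.θhat t i) := by
      rw [τ, if_pos htT]; rfl
    rw [e4] at e1
    -- Linear parametrization turns `M z₁ + C z₂` into `Ω θ`; with `-Ω θ̂` from the controller only
    -- the estimation error remains.
    have e5 : regr L S t i ((L.plant i).θ) = (L.plant i).M (S.q t i) (z1 L S t i)
        + (L.plant i).C (S.q t i) (S.dq t i) (z2 L S t i) := e2.symm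
    have e6 : (L.plant i).M (S.q t i) (S.ddq t i)
        = -((L.η.k2 i * L.μ t) • (S.dq t i + z2 L S t i)) - regr L S t i (S.θhat t i)
          - (L.plant i).C (S.q t i) (S.dq t i) (S.dq t i) := by
      rw [← e1]; abel
    rw [e3, hψ, map_sub (regr L S t i), e5]
    simp only [map_smul, map_add, map_sub, e6]
    module

/-- The Lyapunov function of one agent of the tracking layer. -/
noncomputable def lyapTrack (L : Loop N n p) (S : Signals N n p) (t : ℝ) (i : Fin N) : ℝ :=
  1 / 2 * ‖scaledGap L S t i‖ ^ 2
    + 1 / 2 * inner ℝ (scaledSlide L S t i) ((L.plant i).M (S.q t i) (scaledSlide L S t i))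
    + 1 / 4 * ‖(L.plant i).θ - S.θhat t i‖ ^ 2

/-- The regression term of the energy cancels against the adaptation term. The leakage is written
with `θ̂ = θ - (θ - θ̂)`, the form in which `tracking_dissipation` takes it. -/
theorem hasDerivWithinAt_lyapTrack (hμ : ClassKT L.t0 L.T bt L.μ) (hS : IsSolution L S tEnd)
    {ρ kl ku : Fin N → ℝ} (hsk : ∀ i, (L.plant i).SkewProperty)
    (hΩ : ∀ i, (L.plant i).RegressionProperty (ρ i))
    (hM : ∀ i, (L.plant i).InertiaProperty (kl i) (ku i))
    {t : ℝ} (ht : t ∈ timeDom L.t0 tEnd) (htT : t < L.T + L.t0) (i : Fin N) :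
    HasDerivWithinAt (fun u => lyapTrack L S u i)
      (L.μ t * (inner ℝ (scaledGap L S t i) (scaledSlide L S t i
          - (L.η.k1 i - growth L t) • scaledGap L S t i - scaledRefVel L S z t i)
        + (-(L.η.k2 i * ‖scaledSlide L S t i‖ ^ 2) - L.η.k1 i * inner ℝ (scaledSlide L S t i)
            ((L.plant i).M (S.q t i) (scaledRefVel L S z t i)))
        + 1 / 2 * L.η.σ i * inner ℝ ((L.plant i).θ - S.θhat t i)
            ((L.plant i).θ - ((L.plant i).θ - S.θhat t i)))) (Ici L.t0) t := by
  have htp : t ∈ Tp L.t0 L.T := ⟨ht.1, htT⟩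
  obtain ⟨s', hs', hdyn⟩ := slide_dynamics z hμ hS hΩ ht htT i
  have h1 := ((hasDerivWithinAt_scaledGap z hμ hS ht htT i).norm_sq).const_mul (1 / 2)
  have h2 := hasDerivWithinAt_energy (hsk i) (hM i) (hS.pos_eq t ht i) hs'
  have h3 := (((hS.θhat_eq t ht htT i).const_sub (L.plant i).θ).norm_sq).const_mul (1 / 4)
  refine ((h1.add h2).add h3).congr_deriv ?_
  -- Half of the power `μ^(2ι-2)` goes into the scaling of `s`. The factor `2` matches the weight
  -- `1/4` of the estimation error against `1/2` of the energy.
  have hadapt : adapt L S t i = (2 * L.μ t ^ (L.η.ι - 1)) •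
      ContinuousLinearMap.adjoint (regr L S t i) (scaledSlide L S t i) := by
    have e : L.μ t ^ (2 * L.η.ι - 2) = L.μ t ^ (L.η.ι - 1) * L.μ t ^ (L.η.ι - 1) := by
      rw [← Real.rpow_add (hμ.pos htp)]; congr 1; ring
    rw [adapt, e, scaledSlide, map_smul, smul_smul, mul_assoc]
    rfl
  have hθ : inner ℝ ((L.plant i).θ - S.θhat t i)
        (-(adapt L S t i - (L.η.σ i * L.μ t) • S.θhat t i))
      = -(2 * L.μ t ^ (L.η.ι - 1)) * inner ℝ (scaledSlide L S t i)
          (regr L S t i ((L.plant i).θ - S.θhat t i))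
        + L.η.σ i * L.μ t * inner ℝ ((L.plant i).θ - S.θhat t i) (S.θhat t i) := by
    rw [neg_sub, inner_sub_right, real_inner_smul_right, hadapt, real_inner_smul_right,
      ContinuousLinearMap.adjoint_inner_right, real_inner_comm (scaledSlide L S t i)]
    ring
  rw [hdyn, hθ, sub_sub_cancel, real_inner_smul_right, inner_add_right (scaledSlide L S t i),
    real_inner_smul_right, real_inner_smul_right, inner_sub_right (scaledSlide L S t i),
    inner_neg_right, real_inner_smul_right, real_inner_smul_right, real_inner_self_eq_norm_sq]
  ring

end Scaled

/-! ### The Lyapunov function of the closed loop -/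

/-- The standing assumptions on the closed loop. -/
structure Assumptions {N n p : ℕ} (L : Loop N n p) (bt : ℝ) (ρ kl ku : Fin N → ℝ) (ρc vc cst : ℝ)
    (k1st k2st : Fin N → ℝ) : Prop where
  hN : 2 ≤ N
  T_pos : 0 < L.T
  gain : ClassKT L.t0 L.T bt L.μ
  skew : ∀ i, (L.plant i).SkewProperty
  regression : ∀ i, (L.plant i).RegressionProperty (ρ i)
  inertia : ∀ i, (L.plant i).InertiaProperty (kl i) (ku i)
  connected : L.G.graph.Connected
  cost : CostAssumption L.f ρc vc
  criteria : DesignCriteria L.G ρc vc bt ku L.η cst k1st k2st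

theorem exists_pos_forall_le {ι : Type*} [Finite ι] [Nonempty ι] (u : ι → ℝ) (hu : ∀ i, 0 < u i) :
    ∃ a, 0 < a ∧ ∀ i, a ≤ u i := by
  obtain ⟨i, hi⟩ := Finite.exists_min u
  exact ⟨u i, hu i, hi⟩

theorem exists_pos_forall_ge {ι : Type*} [Finite ι] (u : ι → ℝ) :
    ∃ a, 0 < a ∧ ∀ i, u i ≤ a := by
  obtain ⟨M, hM⟩ := (Set.finite_range u).bddAbove
  exact ⟨max M 1, lt_max_of_lt_right one_pos,
    fun i => (hM (mem_range_self i)).trans (le_max_left _ _)⟩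

section Lyapunov

variable {N n p : ℕ} {L : Loop N n p} {S : Signals N n p} {z : Vec n}
variable {bt ρc vc cst : ℝ} {ρ kl ku k1st k2st : Fin N → ℝ} {tEnd : EReal}

theorem Assumptions.lam2_pos (H : Assumptions L bt ρ kl ku ρc vc cst k1st k2st) : 0 < L.G.lam2 :=
  (L.G.exists_modes H.hN H.connected).1

theorem Assumptions.lam2_le (H : Assumptions L bt ρ kl ku ρc vc cst k1st k2st) :
    L.G.lam2 ≤ L.G.lamMax :=
  (L.G.exists_modes H.hN H.connected).2.1

theorem Assumptions.delta_pos (H : Assumptions L bt ρ kl ku ρc vc cst k1st k2st) :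
    0 < delta L.G.lam2 ρc vc :=
  lt_max_of_lt_left (div_pos four_pos H.lam2_pos)

theorem Assumptions.four_le (H : Assumptions L bt ρ kl ku ρc vc cst k1st k2st) :
    4 ≤ delta L.G.lam2 ρc vc * L.G.lam2 :=
  (div_le_iff₀ H.lam2_pos).1 (le_max_left _ _)

theorem Assumptions.le_delta_mul (H : Assumptions L bt ρ kl ku ρc vc cst k1st k2st) :
    4 * vc ^ 2 + 1 ≤ delta L.G.lam2 ρc vc * ρc :=
  (div_le_iff₀ H.cost.ρc_pos).1 (le_max_right _ _)

theorem Assumptions.deltaLow_pos (H : Assumptions L bt ρ kl ku ρc vc cst k1st k2st) :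
    0 < deltaLow L.G.lam2 L.G.lamMax ρc vc := by
  have h1 : 0 < min 1 L.G.lamMax⁻¹ :=
    lt_min one_pos (inv_pos.2 (H.lam2_pos.trans_le H.lam2_le))
  have := H.delta_pos
  unfold deltaLow
  positivity

/-- The difference is the part of the reference dissipation that survives the coupling with the
tracking layer. -/
theorem Assumptions.deltaLow_lt (H : Assumptions L bt ρ kl ku ρc vc cst k1st k2st) :
    deltaLow L.G.lam2 L.G.lamMax ρc vc < deltaUp L.G.lam2 ρc vc := by
  have h1 : min 1 L.G.lamMax⁻¹ ≤ (1 : ℝ) := min_le_left _ _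
  have h2 : (1 : ℝ) ≤ max 1 L.G.lam2⁻¹ := le_max_left _ _
  have h3 := mul_le_mul_of_nonneg_left (h1.trans h2) H.delta_pos.le
  unfold deltaLow deltaUp
  linarith

theorem Assumptions.c_pos (H : Assumptions L bt ρ kl ku ρc vc cst k1st k2st) : 0 < L.η.c := by
  have h1 := H.deltaLow_pos.trans H.deltaLow_lt
  have h2 := H.criteria.cst_pos
  have h3 := H.gain.bt_pos
  have h4 : 0 < L.η.ι := by linarith [H.criteria.dc1]
  rw [H.criteria.dc2]
  positivity

theorem Assumptions.cS_pos (H : Assumptions L bt ρ kl ku ρc vc cst k1st k2st) :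
    0 < cS L.G.lamMax vc L.η.c := by
  have h1 := H.c_pos
  have h2 := H.lam2_pos.trans_le H.lam2_le
  have h3 := H.cost.vc_pos
  unfold cS
  positivity

theorem Assumptions.cDelta_pos (H : Assumptions L bt ρ kl ku ρc vc cst k1st k2st) :
    0 < cDelta L.G.lam2 L.G.lamMax ρc vc L.η.c := by
  have h1 := H.c_pos
  have h2 := H.lam2_pos.trans_le H.lam2_le
  have h3 := H.cost.vc_pos
  have h4 := H.cost.ρc_pos
  have h5 := H.lam2_pos
  have h6 := H.delta_pos
  unfold cDelta
  positivity

/-- The weight of the tracking layer in the Lyapunov function. -/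
noncomputable def trackWeight (L : Loop N n p) (ρc vc cst : ℝ) : ℝ :=
  2 * cst * deltaLow L.G.lam2 L.G.lamMax ρc vc / cS L.G.lamMax vc L.η.c

theorem Assumptions.trackWeight_pos (H : Assumptions L bt ρ kl ku ρc vc cst k1st k2st) :
    0 < trackWeight L ρc vc cst := by
  have h1 := H.deltaLow_pos
  have h2 := H.criteria.cst_pos
  have h3 := H.cS_pos
  unfold trackWeight
  positivity

/-- The Lyapunov function of the closed loop. -/
noncomputable def lyap (L : Loop N n p) (S : Signals N n p) (z : Vec n) (ρc vc cst : ℝ)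
    (U : Fin N → Fin N → ℝ) (lam : Fin N → ℝ) (t : ℝ) : ℝ :=
  lyapRef (delta L.G.lam2 ρc vc) U lam (scaledRef L S z t) (scaledInt L S z t)
    + trackWeight L ρc vc cst * ∑ i, lyapTrack L S t i

/-- The squared norm of the scaled error. -/
noncomputable def scaledErr (L : Loop N n p) (S : Signals N n p) (z : Vec n) (t : ℝ) : ℝ :=
  ∑ i, (‖scaledRef L S z t i‖ ^ 2 + ‖scaledInt L S z t i‖ ^ 2 + ‖scaledGap L S t i‖ ^ 2
    + ‖scaledSlide L S t i‖ ^ 2 + ‖(L.plant i).θ - S.θhat t i‖ ^ 2)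

theorem IsSolution.sum_v_eq_zero (hS : IsSolution L S tEnd) (hv : ∑ i, S.v L.t0 i = 0)
    {t : ℝ} (ht : t ∈ timeDom L.t0 tEnd) (htT : t < L.T + L.t0) : ∑ i, S.v t i = 0 := by
  have hsub : ∀ u ∈ Icc L.t0 t, u ∈ timeDom L.t0 tEnd ∧ u < L.T + L.t0 := fun u hu =>
    ⟨⟨hu.1, lt_of_le_of_lt (EReal.coe_le_coe_iff.2 hu.2) ht.2⟩, hu.2.trans_lt htT⟩
  have hd : ∀ u ∈ Icc L.t0 t, HasDerivWithinAt (fun u => ∑ i, S.v u i) 0 (Ici L.t0) u := by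
    intro u hu
    have h := HasDerivWithinAt.fun_sum (u := Finset.univ) fun i _ =>
      hS.v_eq u (hsub u hu).1 (hsub u hu).2 i
    refine h.congr_deriv ?_
    rw [← Finset.smul_sum]
    have : ∑ i, relInfo L S u i = 0 := L.G.sum_lap (S.q u)
    rw [this, smul_zero]
  have hc := constant_of_has_deriv_right_zero
    (fun u hu => (hd u hu).continuousWithinAt.mono Icc_subset_Ici_self)
    (fun u hu => (hd u ⟨hu.1, hu.2.le⟩).mono (Ici_subset_Ici.2 hu.1)) t ⟨ht.1, le_rfl⟩
  rw [hc, hv]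

/-- Supplies the zero-sum condition under which the pseudoinverse is effective: the sum of `v` is
conserved and the gradients sum to zero at the optimum. -/
theorem sum_scaledInt (hS : IsSolution L S tEnd) (hv : ∑ i, S.v L.t0 i = 0)
    (hz : ∑ i, gradient (L.f i) z = 0) {t : ℝ} (ht : t ∈ timeDom L.t0 tEnd)
    (htT : t < L.T + L.t0) : ∑ i, scaledInt L S z t i = 0 := by
  simp only [scaledInt]
  rw [← Finset.smul_sum, Finset.sum_add_distrib, hz, hS.sum_v_eq_zero hv ht htT, add_zero,
    smul_zero]

theorem Assumptions.gain_pos (H : Assumptions L bt ρ kl ku ρc vc cst k1st k2st)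
    {t : ℝ} (ht : t ∈ timeDom L.t0 tEnd) (htT : t < L.T + L.t0) : 0 < L.μ t :=
  H.gain.pos ⟨ht.1, htT⟩

theorem Assumptions.growth_bounds (H : Assumptions L bt ρ kl ku ρc vc cst k1st k2st)
    {t : ℝ} (ht : t ∈ timeDom L.t0 tEnd) (htT : t < L.T + L.t0) :
    0 ≤ growth L t ∧ growth L t ≤ L.η.ι * bt := by
  have hι : 0 ≤ L.η.ι := by linarith [H.criteria.dc1]
  have hμ := H.gain_pos ht htT
  have hr := H.gain.rate_nonneg t
  refine ⟨by unfold growth; positivity, mul_le_mul_of_nonneg_left ?_ hι⟩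
  rw [div_le_iff₀ (by positivity)]
  exact H.gain.rate_le t ⟨ht.1, htT⟩

theorem Assumptions.lyapRefDeriv_le (H : Assumptions L bt ρ kl ku ρc vc cst k1st k2st)
    (hS : IsSolution L S tEnd) (hv : ∑ i, S.v L.t0 i = 0) (hz : ∑ i, gradient (L.f i) z = 0)
    {U : Fin N → Fin N → ℝ} {lam : Fin N → ℝ} (hU : Modes L.G U lam)
    {t : ℝ} (ht : t ∈ timeDom L.t0 tEnd) (htT : t < L.T + L.t0) :
    lyapRefDeriv (delta L.G.lam2 ρc vc) U lam (scaledRef L S z t) (scaledInt L S z t)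
        (fun i => growth L t • scaledRef L S z t i + scaledRefVel L S z t i)
        (fun i => growth L t • scaledInt L S z t i
          + L.η.c • L.G.lap (fun j => scaledRef L S z t j + scaledGap L S t j) i)
      ≤ -(deltaUp L.G.lam2 ρc vc * cst)
          * (∑ i, ‖scaledRef L S z t i‖ ^ 2 + ∑ i, ‖scaledInt L S z t i‖ ^ 2)
        + cDelta L.G.lam2 L.G.lamMax ρc vc L.η.c * ∑ i, ‖scaledGap L S t i‖ ^ 2 := by
  obtain ⟨hg0, hg1⟩ := H.growth_bounds ht htT
  have hm : 0 < L.μ t ^ L.η.ι := Real.rpow_pos_of_pos (H.gain_pos ht htT) _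
  have hnorm : ∀ a : Vec n, ‖L.μ t ^ L.η.ι • a‖ = L.μ t ^ L.η.ι * ‖a‖ := fun a => by
    rw [norm_smul, Real.norm_of_nonneg hm.le]
  have key := DPTCO.lyapRefDeriv_le (ψ := scaledRefVel L S z t) (x := scaledRef L S z t)
    (w := scaledInt L S z t) (ξ := scaledGap L S t) (g := scaledGrad L S z t)
    (h := fun i => L.μ t ^ L.η.ι • (gradient (L.f i) (S.ϖ t i) - gradient (L.f i) z))
    H.delta_pos H.cost.ρc_pos H.c_pos hg0 hg1 hU H.lam2_pos H.lam2_le H.le_delta_mul H.four_le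
    (sum_scaledInt hS hv hz ht htT) (fun i => rfl) ?_ ?_ ?_
  · refine key.trans (add_le_add (mul_le_mul_of_nonneg_right ?_ ?_) (le_of_eq ?_))
    -- Half of `c` is `deltaUp c* + 2 ι b̃ + 2 deltaUp ι b̃`; the growth consumes `2 ι b̃ (deltaUp +
    -- 1/2)`, so at least `deltaUp c*` is left.
    · have h1 := H.criteria.dc2
      have h2 : deltaUp L.G.lam2 ρc vc
        = delta L.G.lam2 ρc vc * max 1 L.G.lam2⁻¹ / 2 + 1 / 2 := rfl
      have h3 : 0 ≤ L.η.ι * bt := hg0.trans hg1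
      rw [h1, show delta L.G.lam2 ρc vc * max 1 L.G.lam2⁻¹ / 2
        = deltaUp L.G.lam2 ρc vc - 1 / 2 by rw [h2]; ring]
      linarith
    · exact add_nonneg (Finset.sum_nonneg fun i _ => sq_nonneg _)
        (Finset.sum_nonneg fun i _ => sq_nonneg _)
    · rfl
  · intro i
    have := H.cost.strong i (S.ϖ t i) z
    rw [scaledRef, hnorm, real_inner_smul_left, real_inner_smul_right]
    have := mul_le_mul_of_nonneg_left this (mul_pos hm hm).le
    linarith
  · intro i
    have := mul_le_mul_of_nonneg_left (H.cost.lipschitz i (S.ϖ t i) z) hm.le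
    rw [scaledRef, hnorm, hnorm]
    linarith
  · intro i
    have := mul_le_mul_of_nonneg_left (H.cost.lipschitz i (S.q t i) (S.ϖ t i)) hm.le
    rw [scaledGrad, ← smul_sub, sub_sub_sub_cancel_right, scaledGap, hnorm, hnorm]
    linarith

theorem Assumptions.sum_norm_sq_refVel_le (H : Assumptions L bt ρ kl ku ρc vc cst k1st k2st)
    {t : ℝ} (ht : t ∈ timeDom L.t0 tEnd) (htT : t < L.T + L.t0) :
    ∑ i, ‖scaledRefVel L S z t i‖ ^ 2 ≤ cS L.G.lamMax vc L.η.c / 2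
      * (∑ i, ‖scaledRef L S z t i‖ ^ 2 + ∑ i, ‖scaledInt L S z t i‖ ^ 2
        + ∑ i, ‖scaledGap L S t i‖ ^ 2) := by
  obtain ⟨-, -, U, lam, hU⟩ := L.G.exists_modes H.hN H.connected
  have hm : 0 < L.μ t ^ L.η.ι := Real.rpow_pos_of_pos (H.gain_pos ht htT) _
  have hl := H.lam2_pos.trans_le H.lam2_le
  have hv := H.cost.vc_pos
  refine (sum_norm_sq_reference_le (ψ := scaledRefVel L S z t) (x := scaledRef L S z t)
    (w := scaledInt L S z t) (ξ := scaledGap L S t) (g := scaledGrad L S z t)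
    hv hU H.lam2_pos H.lam2_le (fun i => rfl) ?_).trans ?_
  · intro i
    have e : scaledRef L S z t i + scaledGap L S t i = L.μ t ^ L.η.ι • (S.q t i - z) := by
      simp only [scaledRef, scaledGap]; module
    have := mul_le_mul_of_nonneg_left (H.cost.lipschitz i (S.q t i) z) hm.le
    rw [e, scaledGrad, norm_smul, norm_smul, Real.norm_of_nonneg hm.le]
    linarith
  · refine mul_le_mul_of_nonneg_right ?_ (by positivity)
    unfold cS
    have : (vc + L.G.lamMax + 1) ^ 2 ≤ (2 * L.G.lamMax + vc + 1) ^ 2 :=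
      pow_le_pow_left₀ (by positivity) (by linarith) 2
    nlinarith [mul_le_mul_of_nonneg_left this (sq_nonneg L.η.c)]

theorem Assumptions.lyapTrack_le (H : Assumptions L bt ρ kl ku ρc vc cst k1st k2st)
    (t : ℝ) (i : Fin N) :
    lyapTrack L S t i ≤ 1 / 2 * ‖scaledGap L S t i‖ ^ 2 + 1 / 2 * (ku i * ‖scaledSlide L S t i‖ ^ 2)
      + 1 / 4 * ‖(L.plant i).θ - S.θhat t i‖ ^ 2 := by
  have := (H.inertia i).inner_le (S.q t i) (scaledSlide L S t i)
  unfold lyapTrack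
  linarith

theorem Assumptions.le_lyapTrack (H : Assumptions L bt ρ kl ku ρc vc cst k1st k2st)
    (t : ℝ) (i : Fin N) :
    1 / 2 * ‖scaledGap L S t i‖ ^ 2 + 1 / 2 * (kl i * ‖scaledSlide L S t i‖ ^ 2)
      + 1 / 4 * ‖(L.plant i).θ - S.θhat t i‖ ^ 2 ≤ lyapTrack L S t i := by
  have := (H.inertia i).le_inner (S.q t i) (scaledSlide L S t i)
  unfold lyapTrack
  linarith

/-- The rates with which the terms of the Lyapunov function decay have a common lower bound. -/
theorem Assumptions.exists_rate (H : Assumptions L bt ρ kl ku ρc vc cst k1st k2st) :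
    ∃ a, 0 < a ∧ a * (deltaUp L.G.lam2 ρc vc + 1 / 2)
        ≤ cst * (deltaUp L.G.lam2 ρc vc - deltaLow L.G.lam2 L.G.lamMax ρc vc) ∧
      ∀ i, a * (trackWeight L ρc vc cst * (1 / 2)) ≤ trackWeight L ρc vc cst
          * (k1st i - cS L.G.lamMax vc L.η.c / 2) - cDelta L.G.lam2 L.G.lamMax ρc vc L.η.c ∧
        a * (1 / 2 * ku i) ≤ k2st i ∧ a ≤ L.η.σ i := by
  have hne : Nonempty (Fin N) := ⟨⟨0, by have := H.hN; omega⟩⟩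
  have hdl := H.deltaLow_pos
  have hdu := hdl.trans H.deltaLow_lt
  have hcst := H.criteria.cst_pos
  have hcs := H.cS_pos
  have hcd := H.cDelta_pos
  have hκ := H.trackWeight_pos
  have h1 : ∀ i, 0 < trackWeight L ρc vc cst
      * (k1st i - cS L.G.lamMax vc L.η.c / 2) - cDelta L.G.lam2 L.G.lamMax ρc vc L.η.c := by
    intro i
    have h := mul_lt_mul_of_pos_left (H.criteria.dc4_k1st i) hκ
    -- Times the track weight, the lower bound on `k₁*` equals the load on the gap: `c_Δ` from the
    -- reference layer plus the share of the reference velocity.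
    have e : trackWeight L ρc vc cst * (cS L.G.lamMax vc L.η.c
        * (cDelta L.G.lam2 L.G.lamMax ρc vc L.η.c
          / (cst * deltaLow L.G.lam2 L.G.lamMax ρc vc) + 1) / 2)
        = cDelta L.G.lam2 L.G.lamMax ρc vc L.η.c
          + trackWeight L ρc vc cst * (cS L.G.lamMax vc L.η.c / 2) := by
      unfold trackWeight; field_simp
    rw [e] at h
    linarith
  have h2 : ∀ i, 0 < k2st i := fun i => by
    have h := H.criteria.dc4_k2st i
    have hku := (H.inertia i).ku_pos
    have : 0 ≤ cDelta L.G.lam2 L.G.lamMax ρc vc L.η.c * cS L.G.lamMax vc L.η.c * ku i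
      / (2 * cst * deltaLow L.G.lam2 L.G.lamMax ρc vc) := by positivity
    linarith
  have h3 : ∀ i, 0 < L.η.σ i := fun i =>
    H.gain.bt_pos.trans ((le_max_left _ _).trans_lt (H.criteria.dc3 i))
  obtain ⟨a1, ha1, hb1⟩ := exists_pos_forall_le
    (fun i => (trackWeight L ρc vc cst * (k1st i - cS L.G.lamMax vc L.η.c / 2)
      - cDelta L.G.lam2 L.G.lamMax ρc vc L.η.c) / (trackWeight L ρc vc cst * (1 / 2)))
    fun i => div_pos (h1 i) (by positivity)
  obtain ⟨a2, ha2, hb2⟩ := exists_pos_forall_le (fun i => k2st i / (1 / 2 * ku i))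
    fun i => div_pos (h2 i) (by have := (H.inertia i).ku_pos; positivity)
  obtain ⟨a3, ha3, hb3⟩ := exists_pos_forall_le _ h3
  have ha0 : 0 < cst * (deltaUp L.G.lam2 ρc vc - deltaLow L.G.lam2 L.G.lamMax ρc vc)
      / (deltaUp L.G.lam2 ρc vc + 1 / 2) :=
    div_pos (mul_pos hcst (sub_pos.2 H.deltaLow_lt)) (by positivity)
  refine ⟨min (min _ a1) (min a2 a3), lt_min (lt_min ha0 ha1) (lt_min ha2 ha3), ?_,
    fun i => ⟨?_, ?_, ?_⟩⟩
  · rw [← le_div_iff₀ (by positivity)]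
    exact (min_le_left _ _).trans (min_le_left _ _)
  · rw [← le_div_iff₀ (by positivity)]
    exact ((min_le_left _ _).trans (min_le_right _ _)).trans (hb1 i)
  · rw [← le_div_iff₀ (by have := (H.inertia i).ku_pos; positivity)]
    exact ((min_le_right _ _).trans (min_le_left _ _)).trans (hb2 i)
  · exact ((min_le_right _ _).trans (min_le_right _ _)).trans (hb3 i)

/-- The Lyapunov function decays exponentially, up to a constant, on the time scale `∫ μ`. -/
theorem Assumptions.exists_lyap_deriv_le (H : Assumptions L bt ρ kl ku ρc vc cst k1st k2st)
    (hz : ∑ i, gradient (L.f i) z = 0)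
    {U : Fin N → Fin N → ℝ} {lam : Fin N → ℝ} (hU : Modes L.G U lam) :
    ∃ a b, 0 < a ∧ 0 ≤ b ∧ ∀ (S : Signals N n p) (tEnd : EReal), IsSolution L S tEnd →
      ∑ i, S.v L.t0 i = 0 → ∀ t ∈ timeDom L.t0 tEnd, t < L.T + L.t0 →
        ∃ V', HasDerivWithinAt (lyap L S z ρc vc cst U lam) V' (Ici L.t0) t ∧
          V' ≤ L.μ t * (-(a * lyap L S z ρc vc cst U lam t) + b) := by
  obtain ⟨a, ha, ha0, hai⟩ := H.exists_rate
  have hκ := H.trackWeight_pos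
  have hσ : ∀ i, 0 ≤ L.η.σ i := fun i => ha.le.trans (hai i).2.2
  refine ⟨a, trackWeight L ρc vc cst * ∑ i, 1 / 4 * L.η.σ i * ‖(L.plant i).θ‖ ^ 2, ha,
    mul_nonneg hκ.le (Finset.sum_nonneg fun i _ => by have := hσ i; positivity), ?_⟩
  intro S tEnd hS hv t ht htT
  have d1 := hasDerivWithinAt_lyapRef (δ := delta L.G.lam2 ρc vc) (U := U) (lam := lam)
    (fun i => hasDerivWithinAt_scaledRef z H.gain hS ht htT i)
    (fun i => hasDerivWithinAt_scaledInt z H.gain hS ht htT i)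
  rw [lyapRefDeriv_smul] at d1
  have d2 := HasDerivWithinAt.fun_sum (u := Finset.univ) fun i _ =>
    hasDerivWithinAt_lyapTrack z H.gain hS H.skew H.regression H.inertia ht htT i
  rw [← Finset.mul_sum] at d2
  refine ⟨_, d1.add (d2.const_mul (trackWeight L ρc vc cst)), ?_⟩
  rw [mul_left_comm, ← mul_add]
  refine mul_le_mul_of_nonneg_left ?_ (H.gain_pos ht htT).le
  have e1 := H.lyapRefDeriv_le hS hv hz hU ht htT
  have e2 := Finset.sum_le_sum fun i (_ : i ∈ Finset.univ) =>
    tracking_dissipation (H.inertia i) (k := growth L t) (kι := bt * L.η.ι) (k1s := k1st i)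
      (k2s := k2st i)
      (by rw [mul_comm]; exact (H.growth_bounds ht htT).2) (H.criteria.dc4_k1 i)
      (H.criteria.dc4_k2 i) (hσ i) (S.q t i) (scaledGap L S t i) (scaledSlide L S t i)
      (scaledRefVel L S z t i) ((L.plant i).θ - S.θhat t i) (L.plant i).θ
  have e3 := H.sum_norm_sq_refVel_le (S := S) (z := z) ht htT
  have e4 := lyapRef_le (x := scaledRef L S z t) (w := scaledInt L S z t) H.delta_pos hU H.lam2_pos
  -- The track weight is chosen for this identity: the reference velocity takes `c* deltaLow` out of
  -- the available dissipation `c* deltaUp`.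
  have e5 : trackWeight L ρc vc cst * (cS L.G.lamMax vc L.η.c / 2)
      = cst * deltaLow L.G.lam2 L.G.lamMax ρc vc := by
    have := H.cS_pos
    unfold trackWeight; field_simp
  have hX : 0 ≤ ∑ i, ‖scaledRef L S z t i‖ ^ 2 + ∑ i, ‖scaledInt L S z t i‖ ^ 2 :=
    add_nonneg (Finset.sum_nonneg fun i _ => sq_nonneg _)
      (Finset.sum_nonneg fun i _ => sq_nonneg _)
  have e6 : delta L.G.lam2 ρc vc * max 1 L.G.lam2⁻¹ / 2 + 1 = deltaUp L.G.lam2 ρc vc + 1 / 2 := by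
    unfold deltaUp; ring
  rw [e6] at e4
  unfold lyap
  set X := ∑ i, ‖scaledRef L S z t i‖ ^ 2 + ∑ i, ‖scaledInt L S z t i‖ ^ 2 with hXdef
  set κ := trackWeight L ρc vc cst with hκdef
  have e7 : a * lyapRef (delta L.G.lam2 ρc vc) U lam (scaledRef L S z t) (scaledInt L S z t)
      ≤ cst * (deltaUp L.G.lam2 ρc vc - deltaLow L.G.lam2 L.G.lamMax ρc vc) * X := by
    refine (mul_le_mul_of_nonneg_left e4 ha.le).trans ?_
    rw [← mul_assoc]
    exact mul_le_mul_of_nonneg_right ha0 hX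
  have e8 : ∑ i, (κ * (a * lyapTrack L S t i)
        + κ * (-(k2st i * ‖scaledSlide L S t i‖ ^ 2) - k1st i * ‖scaledGap L S t i‖ ^ 2
          + ‖scaledRefVel L S z t i‖ ^ 2
          - 1 / 4 * L.η.σ i * ‖(L.plant i).θ - S.θhat t i‖ ^ 2
          + 1 / 4 * L.η.σ i * ‖(L.plant i).θ‖ ^ 2))
      ≤ ∑ i, (κ * ‖scaledRefVel L S z t i‖ ^ 2
          + κ * (1 / 4 * L.η.σ i * ‖(L.plant i).θ‖ ^ 2)
          - (κ * (cS L.G.lamMax vc L.η.c / 2) + cDelta L.G.lam2 L.G.lamMax ρc vc L.η.c)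
            * ‖scaledGap L S t i‖ ^ 2) := by
    refine Finset.sum_le_sum fun i _ => ?_
    obtain ⟨f1, f2, f3⟩ := hai i
    have g0 := mul_le_mul_of_nonneg_left (H.lyapTrack_le (S := S) t i) (mul_pos hκ ha).le
    have g1 := mul_le_mul_of_nonneg_right f1 (sq_nonneg ‖scaledGap L S t i‖)
    have g2 := mul_le_mul_of_nonneg_left
      (mul_le_mul_of_nonneg_right f2 (sq_nonneg ‖scaledSlide L S t i‖)) hκ.le
    have g3 := mul_le_mul_of_nonneg_left
      (mul_le_mul_of_nonneg_right f3 (sq_nonneg ‖(L.plant i).θ - S.θhat t i‖)) hκ.le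
    linarith
  have s1 : ∀ l r : Fin N → ℝ, ∑ i, (κ * (a * l i) + κ * r i)
      = κ * (a * ∑ i, l i) + κ * ∑ i, r i := fun l r => by
    rw [Finset.sum_add_distrib, ← Finset.mul_sum, ← Finset.mul_sum, ← Finset.mul_sum]
  have s2 : ∀ (l r m : Fin N → ℝ) (d : ℝ), ∑ i, (κ * l i + κ * r i - d * m i)
      = κ * ∑ i, l i + κ * ∑ i, r i - d * ∑ i, m i := fun l r m d => by
    rw [Finset.sum_sub_distrib, Finset.sum_add_distrib, ← Finset.mul_sum, ← Finset.mul_sum,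
      ← Finset.mul_sum]
  rw [s1, s2] at e8
  have e9 := mul_le_mul_of_nonneg_left e2 hκ.le
  have e10 := mul_le_mul_of_nonneg_left e3 hκ.le
  rw [← mul_assoc, e5] at e10
  rw [e5] at e8
  linarith

end Lyapunov

/-! ### Boundedness of the scaled error -/

section ScaledBound

variable {N n p : ℕ} {L : Loop N n p} {S : Signals N n p} {z : Vec n}
variable {bt ρc vc cst : ℝ} {ρ kl ku k1st k2st : Fin N → ℝ} {tEnd : EReal}

theorem Icc_subset_timeDom {t0 : ℝ} {t : ℝ} (ht : t ∈ timeDom t0 tEnd) :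
    Icc t0 t ⊆ timeDom t0 tEnd :=
  fun _ hu => ⟨hu.1, lt_of_le_of_lt (EReal.coe_le_coe_iff.2 hu.2) ht.2⟩

theorem scaledErr_eq (t : ℝ) :
    scaledErr L S z t = ∑ i, ‖scaledRef L S z t i‖ ^ 2 + ∑ i, ‖scaledInt L S z t i‖ ^ 2
      + ∑ i, (‖scaledGap L S t i‖ ^ 2 + ‖scaledSlide L S t i‖ ^ 2
        + ‖(L.plant i).θ - S.θhat t i‖ ^ 2) := by
  rw [scaledErr, ← Finset.sum_add_distrib, ← Finset.sum_add_distrib]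
  exact Finset.sum_congr rfl fun i _ => by ring

theorem Assumptions.exists_lyap_le (H : Assumptions L bt ρ kl ku ρc vc cst k1st k2st)
    {U : Fin N → Fin N → ℝ} {lam : Fin N → ℝ} (hU : Modes L.G U lam) :
    ∃ C, 0 < C ∧ ∀ (S : Signals N n p) (t : ℝ),
      lyap L S z ρc vc cst U lam t ≤ C * scaledErr L S z t := by
  obtain ⟨K, hK, hku⟩ := exists_pos_forall_ge ku
  have hκ := H.trackWeight_pos
  set κ := trackWeight L ρc vc cst with hκdef
  set d := delta L.G.lam2 ρc vc * max 1 L.G.lam2⁻¹ / 2 + 1 with hd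
  have hd0 : 0 < d := by
    have h1 := H.delta_pos
    have h2 : (0 : ℝ) < max 1 L.G.lam2⁻¹ := lt_max_of_lt_left one_pos
    positivity
  refine ⟨d + κ * (1 + K), by positivity, fun S t => ?_⟩
  rw [scaledErr_eq]
  set X := ∑ i, ‖scaledRef L S z t i‖ ^ 2 + ∑ i, ‖scaledInt L S z t i‖ ^ 2
  have hX : 0 ≤ X := add_nonneg (Finset.sum_nonneg fun i _ => sq_nonneg _)
    (Finset.sum_nonneg fun i _ => sq_nonneg _)
  set Y := ∑ i, (‖scaledGap L S t i‖ ^ 2 + ‖scaledSlide L S t i‖ ^ 2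
        + ‖(L.plant i).θ - S.θhat t i‖ ^ 2)
  have hY : 0 ≤ Y := Finset.sum_nonneg fun i _ => by positivity
  have h1 : lyapRef (delta L.G.lam2 ρc vc) U lam (scaledRef L S z t) (scaledInt L S z t) ≤ d * X :=
    lyapRef_le H.delta_pos hU H.lam2_pos
  have h2 : ∑ i, lyapTrack L S t i ≤ (1 + K) * Y := by
    rw [Finset.mul_sum]
    refine Finset.sum_le_sum fun i _ => (H.lyapTrack_le t i).trans ?_
    have a1 := mul_le_mul_of_nonneg_right (hku i) (sq_nonneg ‖scaledSlide L S t i‖)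
    have a2 := mul_nonneg hK.le (sq_nonneg ‖scaledSlide L S t i‖)
    have a3 := mul_nonneg hK.le (sq_nonneg ‖scaledGap L S t i‖)
    have a4 := mul_nonneg hK.le (sq_nonneg ‖(L.plant i).θ - S.θhat t i‖)
    have a5 := sq_nonneg ‖scaledSlide L S t i‖
    have a6 := sq_nonneg ‖scaledGap L S t i‖
    have a7 := sq_nonneg ‖(L.plant i).θ - S.θhat t i‖
    linarith
  have h3 := mul_le_mul_of_nonneg_left h2 hκ.le
  have h4 := mul_nonneg hd0.le hY
  have h5 : 0 ≤ κ * (1 + K) * X := by positivity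
  rw [lyap]
  linarith

theorem Assumptions.exists_le_lyap (H : Assumptions L bt ρ kl ku ρc vc cst k1st k2st)
    {U : Fin N → Fin N → ℝ} {lam : Fin N → ℝ} (hU : Modes L.G U lam) :
    ∃ C, 0 < C ∧ ∀ (S : Signals N n p) (t : ℝ), ∑ i, scaledInt L S z t i = 0 →
      C * scaledErr L S z t ≤ lyap L S z ρc vc cst U lam t := by
  have hne : Nonempty (Fin N) := ⟨⟨0, by have := H.hN; omega⟩⟩
  obtain ⟨K, hK, hkl⟩ := exists_pos_forall_le kl fun i => (H.inertia i).kl_pos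
  have hκ := H.trackWeight_pos
  set κ := trackWeight L ρc vc cst with hκdef
  have hd0 := H.deltaLow_pos
  set d := deltaLow L.G.lam2 L.G.lamMax ρc vc with hd
  set K' := min (1 / 4) (K / 2) with hK'
  have hK'0 : 0 < K' := lt_min (by norm_num) (by positivity)
  have hm1 : min d (κ * K') ≤ d := min_le_left _ _
  have hm2 : min d (κ * K') ≤ κ * K' := min_le_right _ _
  refine ⟨min d (κ * K'), lt_min hd0 (by positivity), fun S t hw => ?_⟩
  rw [scaledErr_eq]
  set X := ∑ i, ‖scaledRef L S z t i‖ ^ 2 + ∑ i, ‖scaledInt L S z t i‖ ^ 2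
  have hX : 0 ≤ X := add_nonneg (Finset.sum_nonneg fun i _ => sq_nonneg _)
    (Finset.sum_nonneg fun i _ => sq_nonneg _)
  set Y := ∑ i, (‖scaledGap L S t i‖ ^ 2 + ‖scaledSlide L S t i‖ ^ 2
        + ‖(L.plant i).θ - S.θhat t i‖ ^ 2)
  have hY : 0 ≤ Y := Finset.sum_nonneg fun i _ => by positivity
  have h1 : d * X ≤ lyapRef (delta L.G.lam2 ρc vc) U lam (scaledRef L S z t) (scaledInt L S z t) :=
    le_lyapRef H.delta_pos hU H.lam2_pos hw
  have h2 : K' * Y ≤ ∑ i, lyapTrack L S t i := by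
    rw [Finset.mul_sum]
    refine Finset.sum_le_sum fun i _ => le_trans ?_ (H.le_lyapTrack t i)
    have b1 : K' ≤ 1 / 4 := min_le_left _ _
    have b2 : K' ≤ 1 / 2 * kl i := (min_le_right _ _).trans (by linarith [hkl i])
    have a5 := mul_le_mul_of_nonneg_right b2 (sq_nonneg ‖scaledSlide L S t i‖)
    have a6 := mul_le_mul_of_nonneg_right b1 (sq_nonneg ‖scaledGap L S t i‖)
    have a7 := mul_le_mul_of_nonneg_right b1 (sq_nonneg ‖(L.plant i).θ - S.θhat t i‖)
    have a8 := sq_nonneg ‖scaledGap L S t i‖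
    linarith
  have h3 := mul_le_mul_of_nonneg_left h2 hκ.le
  have h4 := mul_le_mul_of_nonneg_right hm1 hX
  have h5 := mul_le_mul_of_nonneg_right hm2 hY
  rw [lyap]
  linarith

theorem errNorm_sq (t : ℝ) :
    errNorm L S z t ^ 2 = ∑ i, (‖S.ϖ t i - z‖ ^ 2 + ‖S.v t i + gradient (L.f i) z‖ ^ 2
      + ‖S.y t i - S.ϖ t i‖ ^ 2 + ‖S.dq t i‖ ^ 2) :=
  Real.sq_sqrt (Finset.sum_nonneg fun i _ => by positivity)

theorem estErrNorm_sq (t : ℝ) :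
    estErrNorm L S t ^ 2 = ∑ i, ‖(L.plant i).θ - S.θhat t i‖ ^ 2 :=
  Real.sq_sqrt (Finset.sum_nonneg fun i _ => by positivity)

theorem norm_add_sq_le_two_mul {E : Type*} [SeminormedAddCommGroup E] (x y : E) :
    ‖x + y‖ ^ 2 ≤ 2 * (‖x‖ ^ 2 + ‖y‖ ^ 2) := by
  nlinarith [norm_add_le x y, sq_nonneg (‖x‖ - ‖y‖), norm_nonneg (x + y)]

/-- At `t₀` all gains are fixed numbers, so the constant does not depend on the solution. -/
theorem exists_scaledErr_init_le (L : Loop N n p) (z : Vec n) :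
    ∃ C, 0 < C ∧ ∀ S : Signals N n p, scaledErr L S z L.t0
      ≤ C * (errNorm L S z L.t0 ^ 2 + estErrNorm L S L.t0 ^ 2) := by
  set m := L.μ L.t0 ^ L.η.ι with hm
  set r := L.μ L.t0 ^ (L.η.ι - 1) with hr
  obtain ⟨K, hK, hk⟩ := exists_pos_forall_ge fun i => (L.η.k1 i * L.μ L.t0) ^ 2
  refine ⟨m ^ 2 + 2 * r ^ 2 * (1 + K) + 1, by positivity, fun S => ?_⟩
  rw [errNorm_sq, estErrNorm_sq, ← Finset.sum_add_distrib, Finset.mul_sum]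
  refine Finset.sum_le_sum fun i _ => ?_
  have hs : ‖scaledSlide L S L.t0 i‖ ^ 2
      ≤ r ^ 2 * (2 * (‖S.dq L.t0 i‖ ^ 2 + K * ‖S.q L.t0 i - S.ϖ L.t0 i‖ ^ 2)) := by
    rw [scaledSlide, norm_smul, mul_pow, Real.norm_eq_abs, sq_abs]
    refine mul_le_mul_of_nonneg_left ((norm_add_sq_le_two_mul _ _).trans ?_) (sq_nonneg _)
    rw [norm_smul, mul_pow, Real.norm_eq_abs, sq_abs]
    have := mul_le_mul_of_nonneg_right (hk i) (sq_nonneg ‖S.q L.t0 i - S.ϖ L.t0 i‖)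
    linarith
  rw [scaledRef, scaledInt, scaledGap, norm_smul, norm_smul, norm_smul, mul_pow, mul_pow, mul_pow,
    Real.norm_eq_abs, sq_abs, Signals.y]
  have q1 := sq_nonneg ‖S.ϖ L.t0 i - z‖
  have q2 := sq_nonneg ‖S.v L.t0 i + gradient (L.f i) z‖
  have q3 := sq_nonneg ‖S.q L.t0 i - S.ϖ L.t0 i‖
  have q4 := sq_nonneg ‖S.dq L.t0 i‖
  have q5 := sq_nonneg ‖(L.plant i).θ - S.θhat L.t0 i‖
  have w1 : 0 ≤ 2 * r ^ 2 * (1 + K) + 1 := by positivity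
  have w2 : 0 ≤ m ^ 2 + 2 * r ^ 2 * K + 1 := by positivity
  have w3 : 0 ≤ m ^ 2 + 2 * r ^ 2 * (1 + K) := by positivity
  have w4 : 0 ≤ 2 * r ^ 2 + 1 := by positivity
  have p1 := mul_nonneg w1 q1
  have p2 := mul_nonneg w1 q2
  have p3 := mul_nonneg w4 q3
  have p4 := mul_nonneg w2 q4
  have p5 := mul_nonneg w3 q5
  linarith

/-- Three components have a power of `μ` to spare, which costs `1/μ(t₀)`. The velocity has none:
`μ^(ι-1) q'` is the scaled sliding variable minus `k₁` times the scaled gap. -/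
theorem Assumptions.exists_errNorm_le (H : Assumptions L bt ρ kl ku ρc vc cst k1st k2st)
    (z : Vec n) :
    ∃ C, 0 < C ∧ ∀ (S : Signals N n p), ∀ t ∈ Tp L.t0 L.T,
      (L.μ t ^ (L.η.ι - 1) * errNorm L S z t) ^ 2 ≤ C * scaledErr L S z t := by
  have hμ0 := H.gain.init_pos H.T_pos
  obtain ⟨K, hK, hk⟩ := exists_pos_forall_ge fun i => L.η.k1 i ^ 2
  refine ⟨(L.μ L.t0)⁻¹ ^ 2 + 2 + 2 * K, by positivity, fun S t ht => ?_⟩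
  have hpos := H.gain.pos ht
  have hinv : (L.μ t)⁻¹ ^ 2 ≤ (L.μ L.t0)⁻¹ ^ 2 :=
    pow_le_pow_left₀ (inv_pos.2 hpos).le (inv_anti₀ hμ0 (H.gain.init_le ht)) 2
  rw [mul_pow, errNorm_sq, scaledErr, Finset.mul_sum, Finset.mul_sum]
  refine Finset.sum_le_sum fun i _ => ?_
  set r := L.μ t ^ (L.η.ι - 1) with hr
  have hm : L.μ t ^ L.η.ι = L.μ t * r := gain_eq_mul H.gain ht
  have hscale : ∀ a : Vec n, r ^ 2 * ‖a‖ ^ 2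
      ≤ (L.μ L.t0)⁻¹ ^ 2 * ‖L.μ t ^ L.η.ι • a‖ ^ 2 := by
    intro a
    have e : r ^ 2 * ‖a‖ ^ 2 = (L.μ t)⁻¹ ^ 2 * ‖L.μ t ^ L.η.ι • a‖ ^ 2 := by
      rw [hm, norm_smul, mul_pow, Real.norm_eq_abs, sq_abs]
      field_simp
    rw [e]
    exact mul_le_mul_of_nonneg_right hinv (sq_nonneg _)
  have h1 := hscale (S.ϖ t i - z)
  have h2 := hscale (S.v t i + gradient (L.f i) z)
  have h3 := hscale (S.q t i - S.ϖ t i)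
  have h4 : r ^ 2 * ‖S.dq t i‖ ^ 2
      ≤ 2 * (‖scaledSlide L S t i‖ ^ 2 + K * ‖scaledGap L S t i‖ ^ 2) := by
    have e : r • S.dq t i = scaledSlide L S t i + (-L.η.k1 i) • scaledGap L S t i := by
      rw [scaledSlide, scaledGap, hm, ← hr]; module
    have e2 : r ^ 2 * ‖S.dq t i‖ ^ 2 = ‖r • S.dq t i‖ ^ 2 := by
      rw [norm_smul, mul_pow, Real.norm_eq_abs, sq_abs]
    rw [e2, e]
    refine (norm_add_sq_le_two_mul _ _).trans ?_
    rw [norm_smul, mul_pow, Real.norm_eq_abs, sq_abs, neg_sq]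
    have := mul_le_mul_of_nonneg_right (hk i) (sq_nonneg ‖scaledGap L S t i‖)
    linarith
  change r ^ 2 * ‖S.ϖ t i - z‖ ^ 2 ≤ (L.μ L.t0)⁻¹ ^ 2 * ‖scaledRef L S z t i‖ ^ 2 at h1
  change r ^ 2 * ‖S.v t i + gradient (L.f i) z‖ ^ 2
    ≤ (L.μ L.t0)⁻¹ ^ 2 * ‖scaledInt L S z t i‖ ^ 2 at h2
  change r ^ 2 * ‖S.q t i - S.ϖ t i‖ ^ 2 ≤ (L.μ L.t0)⁻¹ ^ 2 * ‖scaledGap L S t i‖ ^ 2 at h3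
  rw [Signals.y]
  have q1 := sq_nonneg ‖scaledRef L S z t i‖
  have q2 := sq_nonneg ‖scaledInt L S z t i‖
  have q3 := sq_nonneg ‖scaledGap L S t i‖
  have q4 := sq_nonneg ‖scaledSlide L S t i‖
  have q5 := sq_nonneg ‖(L.plant i).θ - S.θhat t i‖
  have w : 0 ≤ (L.μ L.t0)⁻¹ ^ 2 := sq_nonneg _
  have p1 := mul_nonneg hK.le q1
  have p2 := mul_nonneg hK.le q2
  have p4 := mul_nonneg hK.le q4
  have p5 := mul_nonneg hK.le q5
  have p6 := mul_nonneg w q4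
  have p7 := mul_nonneg w q5
  linarith

/-- The scaled error is bounded in terms of the initial error. -/
theorem Assumptions.exists_scaledErr_le (H : Assumptions L bt ρ kl ku ρc vc cst k1st k2st)
    (hz : ∑ i, gradient (L.f i) z = 0) :
    ∃ C, 0 < C ∧ ∀ (S : Signals N n p) (tEnd : EReal), IsSolution L S tEnd →
      ∑ i, S.v L.t0 i = 0 → ∀ t ∈ timeDom L.t0 tEnd, t < L.T + L.t0 →
        scaledErr L S z t ≤ C * (errNorm L S z L.t0 ^ 2 + estErrNorm L S L.t0 ^ 2 + 1) := by
  obtain ⟨-, -, U, lam, hU⟩ := L.G.exists_modes H.hN H.connected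
  obtain ⟨a, b, ha, hb, hd⟩ := H.exists_lyap_deriv_le hz hU
  obtain ⟨C1, hC1, h1⟩ := H.exists_lyap_le (z := z) hU
  obtain ⟨C2, hC2, h2⟩ := H.exists_le_lyap (z := z) hU
  obtain ⟨C3, hC3, h3⟩ := exists_scaledErr_init_le L z
  have hba : 0 ≤ b / a := div_nonneg hb ha.le
  refine ⟨(C1 * C3 + b / a + 1) / C2, by positivity, fun S tEnd hS hv t ht htT => ?_⟩
  have hsub : ∀ u ∈ Icc L.t0 t, u ∈ timeDom L.t0 tEnd ∧ u < L.T + L.t0 := fun u hu =>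
    ⟨Icc_subset_timeDom ht hu, hu.2.trans_lt htT⟩
  set V := lyap L S z ρc vc cst U lam with hV
  have hsum : ∀ u ∈ timeDom L.t0 tEnd, u < L.T + L.t0 → ∑ i, scaledInt L S z u i = 0 :=
    fun u hu huT => sum_scaledInt hS hv hz hu huT
  have hVnn : 0 ≤ V L.t0 := by
    have ht0 := hsub L.t0 ⟨le_rfl, ht.1⟩
    refine le_trans (mul_nonneg hC2.le ?_) (h2 S L.t0 (hsum _ ht0.1 ht0.2))
    exact Finset.sum_nonneg fun i _ => by positivity
  choose! V' hV' hVle using fun u (hu : u ∈ Icc L.t0 t) =>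
    hd S tEnd hS hv u (hsub u hu).1 (hsub u hu).2
  -- A constant barrier suffices. Where `V` meets it, `-a V + b = -a (V(t₀) + 1) < 0`, since `V(t₀)
  -- ≥ 0`; the `1` makes the inequality strict.
  have hbound : V t ≤ V L.t0 + b / a + 1 := by
    refine image_le_of_deriv_right_lt_deriv_boundary' (f := V) (f' := V')
      (B := fun _ => V L.t0 + b / a + 1) (B' := fun _ => 0) (a := L.t0) (b := t)
      (fun u hu => (hV' u hu).continuousWithinAt.mono Icc_subset_Ici_self)
      (fun u hu => (hV' u ⟨hu.1, hu.2.le⟩).mono (Ici_subset_Ici.2 hu.1)) (by linarith)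
      continuousOn_const (fun u _ => hasDerivWithinAt_const _ _ _) ?_ ⟨ht.1, le_rfl⟩
    intro u hu hVu
    have hu' : u ∈ Icc L.t0 t := ⟨hu.1, hu.2.le⟩
    refine (hVle u hu').trans_lt
      (mul_neg_of_pos_of_neg (H.gain_pos (hsub u hu').1 (hsub u hu').2) ?_)
    rw [← hV, hVu]
    have e : a * (V L.t0 + b / a + 1) = a * V L.t0 + b + a := by field_simp
    rw [e]
    have := mul_nonneg ha.le hVnn
    linarith
  rw [div_mul_eq_mul_div, le_div_iff₀ hC2, mul_comm]
  refine (h2 S t (hsum t ht htT)).trans (hbound.trans ?_)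
  have h4 := (h1 S L.t0).trans (mul_le_mul_of_nonneg_left (h3 S) hC1.le)
  have h5 : 0 ≤ (b / a + 1) * (errNorm L S z L.t0 ^ 2 + estErrNorm L S L.t0 ^ 2) := by positivity
  have h6 : 0 ≤ C1 * C3 := by positivity
  linarith

end ScaledBound

/-! ### The class `𝒦ℒ_T^e` bound -/

section Decay

variable {t0 T bt q : ℝ} {μ : ℝ → ℝ}

open Classical in
/-- The function `μ(t₀ + s)^(-q)` of `s`, continued by zero. -/
noncomputable def decay (t0 T : ℝ) (μ : ℝ → ℝ) (q s : ℝ) : ℝ :=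
  if s < T then (μ (t0 + s) ^ q)⁻¹ else 0

theorem add_mem_Tp {s : ℝ} (hs : s ∈ Ico 0 T) : t0 + s ∈ Tp t0 T :=
  ⟨by linarith [hs.1], by linarith [hs.2]⟩

theorem ClassKT.decay_pos (h : ClassKT t0 T bt μ) {s : ℝ} (hs : s ∈ Ico 0 T) :
    0 < decay t0 T μ q s := by
  rw [decay, if_pos hs.2]
  exact inv_pos.2 (Real.rpow_pos_of_pos (h.pos (add_mem_Tp hs)) _)

theorem decay_of_le {s : ℝ} (hs : T ≤ s) : decay t0 T μ q s = 0 := if_neg hs.not_gt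

theorem ClassKT.decay_strictAntiOn (h : ClassKT t0 T bt μ) (hq : 0 < q) :
    StrictAntiOn (decay t0 T μ q) (Ico 0 T) := by
  intro a ha b hb hab
  rw [decay, decay, if_pos ha.2, if_pos hb.2]
  have ha' := add_mem_Tp (t0 := t0) ha
  refine inv_strictAnti₀ (Real.rpow_pos_of_pos (h.pos ha') _) ?_
  exact Real.rpow_lt_rpow (h.pos ha').le
    (h.strictMono ha' (add_mem_Tp hb) (by linarith)) hq

theorem ClassKT.decay_tendsto (h : ClassKT t0 T bt μ) (hq : 0 < q) :
    Tendsto (decay t0 T μ q) (𝓝[<] T) (𝓝 0) := by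
  have h1 : Tendsto (fun s => t0 + s) (𝓝[<] T) (𝓝[<] (T + t0)) := by
    refine tendsto_nhdsWithin_of_tendsto_nhds_of_eventually_within _ ?_ ?_
    · have : Tendsto (fun s => t0 + s) (𝓝 T) (𝓝 (t0 + T)) := (continuous_const_add t0).tendsto T
      rw [add_comm T t0]
      exact this.mono_left nhdsWithin_le_nhds
    · filter_upwards [self_mem_nhdsWithin] with s hs
      have : s < T := hs
      change t0 + s < T + t0
      linarith
  have h2 := tendsto_inv_atTop_zero.comp
    ((tendsto_rpow_atTop hq).comp (h.tendsto_top.comp h1))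
  refine h2.congr' ?_
  filter_upwards [self_mem_nhdsWithin] with s hs
  rw [decay, if_pos (show s < T from hs)]
  rfl

theorem ClassKT.decay_continuousOn (h : ClassKT t0 T bt μ) (hq : 0 < q) :
    ContinuousOn (decay t0 T μ q) (Ici 0) := by
  intro s hs
  rcases lt_trichotomy s T with hsT | rfl | hsT
  · have hmem : s ∈ Ico 0 T := ⟨hs, hsT⟩
    have h1 : ContinuousWithinAt (fun u => t0 + u) (Ici 0) s :=
      (continuous_const_add t0).continuousWithinAt
    have h2 : ContinuousWithinAt (fun u => μ (t0 + u)) (Ici 0) s :=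
      (h.hasDerivWithinAt (add_mem_Tp hmem)).continuousWithinAt.comp h1
        (fun u (hu : 0 ≤ u) => by change t0 ≤ t0 + u; linarith)
    have hpos := h.pos (add_mem_Tp hmem)
    have h3 := (h2.rpow_const (p := q) (Or.inl hpos.ne')).inv₀ (Real.rpow_pos_of_pos hpos q).ne'
    refine h3.congr_of_eventuallyEq ?_ (if_pos hsT)
    filter_upwards [mem_nhdsWithin_of_mem_nhds (Iio_mem_nhds hsT)] with u hu
    exact if_pos hu
  -- At `T` the limit zero from the left is glued to the constant zero on the right.
  · refine ContinuousAt.continuousWithinAt ?_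
    rw [ContinuousAt, decay_of_le le_rfl, ← nhdsLT_sup_nhdsGE]
    refine (h.decay_tendsto hq).sup (tendsto_const_nhds.congr' ?_)
    filter_upwards [self_mem_nhdsWithin] with u hu
    exact (decay_of_le hu).symm
  · refine ContinuousAt.continuousWithinAt ?_
    refine (continuousAt_const (y := (0 : ℝ))).congr ?_
    filter_upwards [Ioi_mem_nhds hsT] with u hu
    exact (decay_of_le (le_of_lt hu)).symm

/-- Being affine in `r` with `K2 > 0` is what gives positivity at `r = 0`. -/
theorem ClassKT.classKLTE (h : ClassKT t0 T bt μ) (hq : 0 < q) {K1 K2 : ℝ} (hK1 : 0 < K1)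
    (hK2 : 0 < K2) : ClassKLTE T fun r s => (K1 * r + K2) * decay t0 T μ q s := by
  have hK : ∀ r, 0 ≤ r → 0 < K1 * r + K2 := fun r hr => by positivity
  refine ⟨?_, ?_, ?_, ?_, ?_, ?_⟩
  · refine ContinuousOn.mul (by fun_prop) ?_
    exact (h.decay_continuousOn hq).comp continuousOn_snd fun x hx => hx.2
  · intro r hr s hs
    rcases lt_or_ge s T with hsT | hsT
    · exact mul_nonneg (hK r hr).le (h.decay_pos ⟨hs, hsT⟩).le
    · simp only [decay_of_le hsT, mul_zero, le_refl]
  · intro s hs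
    have hd := h.decay_pos (q := q) hs
    refine ⟨by fun_prop, ?_, ?_, ?_⟩
    · intro a _ b _ hab
      exact mul_lt_mul_of_pos_right (by have := mul_lt_mul_of_pos_left hab hK1; linarith) hd
    · exact mul_pos (hK 0 le_rfl) hd
    · exact (tendsto_atTop_add_const_right _ _ (tendsto_id.const_mul_atTop hK1)).atTop_mul_const hd
  · intro r hr a ha b hb hab
    exact mul_lt_mul_of_pos_left (h.decay_strictAntiOn hq ha hb hab) (hK r hr)
  · intro r _
    simpa using (h.decay_tendsto hq).const_mul (K1 * r + K2)
  · intro r _ s hs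
    simp only [decay_of_le hs, mul_zero]

end Decay

/-! ### Convergence -/

section Convergence

variable {N n p : ℕ} {L : Loop N n p} {S : Signals N n p} {z : Vec n}
variable {bt ρc vc cst : ℝ} {ρ kl ku k1st k2st : Fin N → ℝ} {tEnd : EReal}

/-- Before the prescribed time, the error decays like `μ^(1-ι)`. -/
theorem Assumptions.exists_errNorm_le_decay (H : Assumptions L bt ρ kl ku ρc vc cst k1st k2st)
    (hz : ∑ i, gradient (L.f i) z = 0) (R : ℝ) :
    ∃ K1 K2, 0 < K1 ∧ 0 < K2 ∧ ∀ (S : Signals N n p) (tEnd : EReal), IsSolution L S tEnd →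
      ∑ i, S.v L.t0 i = 0 → estErrNorm L S L.t0 ≤ R → ∀ t ∈ timeDom L.t0 tEnd, t < L.T + L.t0 →
        errNorm L S z t ≤ (K1 * errNorm L S z L.t0 + K2)
          * decay L.t0 L.T L.μ (L.η.ι - 1) (t - L.t0) := by
  obtain ⟨C, hC, h1⟩ := H.exists_scaledErr_le hz
  obtain ⟨D, hD, h2⟩ := H.exists_errNorm_le z
  set K := Real.sqrt (D * C) with hK
  have hK0 : 0 < K := Real.sqrt_pos.2 (by positivity)
  have hKsq : K ^ 2 = D * C := Real.sq_sqrt (by positivity)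
  -- From `e² + R² + 1 ≤ (e + |R| + 1)²`; the absolute value keeps the constant positive for every
  -- `R`.
  refine ⟨K, K * (|R| + 1), hK0, by positivity, fun S tEnd hS hv hR t ht htT => ?_⟩
  have hr : 0 < L.μ t ^ (L.η.ι - 1) := Real.rpow_pos_of_pos (H.gain_pos ht htT) _
  rw [decay, if_pos (by linarith), add_sub_cancel, ← div_eq_mul_inv, le_div_iff₀ hr]
  have he : 0 ≤ errNorm L S z L.t0 := Real.sqrt_nonneg _
  have hest : estErrNorm L S L.t0 ^ 2 ≤ |R| ^ 2 :=
    pow_le_pow_left₀ (Real.sqrt_nonneg _) (hR.trans (le_abs_self R)) 2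
  refine le_of_sq_le_sq ?_ (by positivity)
  calc (errNorm L S z t * L.μ t ^ (L.η.ι - 1)) ^ 2
      = (L.μ t ^ (L.η.ι - 1) * errNorm L S z t) ^ 2 := by rw [mul_comm]
    _ ≤ D * (C * (errNorm L S z L.t0 ^ 2 + estErrNorm L S L.t0 ^ 2 + 1)) :=
        (h2 S t ⟨ht.1, htT⟩).trans (mul_le_mul_of_nonneg_left (h1 S tEnd hS hv t ht htT) hD.le)
    _ ≤ K ^ 2 * (errNorm L S z L.t0 + (|R| + 1)) ^ 2 := by
        rw [hKsq, mul_assoc]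
        refine mul_le_mul_of_nonneg_left (mul_le_mul_of_nonneg_left ?_ hC.le) hD.le
        have := mul_nonneg he (by positivity : 0 ≤ |R| + 1)
        nlinarith [abs_nonneg R]
    _ = (K * errNorm L S z L.t0 + K * (|R| + 1)) ^ 2 := by ring

theorem IsSolution.q_continuousOn (hS : IsSolution L S tEnd) (i : Fin N) :
    ContinuousOn (fun t => S.q t i) (timeDom L.t0 tEnd) :=
  fun t ht => (hS.pos_eq t ht i).continuousWithinAt.mono fun _ hu => hu.1

theorem IsSolution.errNorm_continuousOn (hS : IsSolution L S tEnd) :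
    ContinuousOn (errNorm L S z) (timeDom L.t0 tEnd) := by
  refine (continuousOn_finsetSum _ fun i _ => ?_).sqrt
  have h1 := hS.ϖ_cont i
  have h2 := hS.v_cont i
  have h3 := hS.dq_cont i
  have h4 := hS.q_continuousOn i
  exact ((((h1.sub continuousOn_const).norm.pow 2).add
    ((h2.add continuousOn_const).norm.pow 2)).add ((h4.sub h1).norm.pow 2)).add (h3.norm.pow 2)

theorem eq_of_errNorm_eq_zero {t : ℝ} (h : errNorm L S z t = 0) (i : Fin N) :
    S.ϖ t i = z ∧ S.v t i = -gradient (L.f i) z ∧ S.q t i = z ∧ S.dq t i = 0 := by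
  have h1 := errNorm_sq (L := L) (S := S) (z := z) t
  rw [h, zero_pow two_ne_zero] at h1
  have h2 := (Finset.sum_eq_zero_iff_of_nonneg (fun i _ => by positivity)).1 h1.symm i
    (Finset.mem_univ i)
  have q1 := sq_nonneg ‖S.ϖ t i - z‖
  have q2 := sq_nonneg ‖S.v t i + gradient (L.f i) z‖
  have q3 := sq_nonneg ‖S.y t i - S.ϖ t i‖
  have q4 := sq_nonneg ‖S.dq t i‖
  have hz : ∀ x : Vec n, ‖x‖ ^ 2 ≤ 0 → x = 0 := fun x hx =>
    norm_eq_zero.1 (pow_eq_zero_iff two_ne_zero |>.1 (le_antisymm hx (sq_nonneg _)))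
  have e1 : S.ϖ t i = z := sub_eq_zero.1 (hz _ (by linarith))
  have e3 : S.q t i = S.ϖ t i := sub_eq_zero.1 (hz (S.y t i - S.ϖ t i) (by linarith))
  exact ⟨e1, eq_neg_of_add_eq_zero_left (hz _ (by linarith)), e3.trans e1, hz _ (by linarith)⟩

theorem Assumptions.errNorm_eq_zero (H : Assumptions L bt ρ kl ku ρc vc cst k1st k2st)
    (hz : ∑ i, gradient (L.f i) z = 0) (hS : IsSolution L S tEnd) (hv : ∑ i, S.v L.t0 i = 0)
    (hT : L.T + L.t0 ∈ timeDom L.t0 tEnd) : errNorm L S z (L.T + L.t0) = 0 := by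
  have hq : 0 < L.η.ι - 1 := by linarith [H.criteria.dc1]
  obtain ⟨K1, K2, -, -, h⟩ := H.exists_errNorm_le_decay hz (estErrNorm L S L.t0)
  have hlt : L.t0 < L.T + L.t0 := by linarith [H.T_pos]
  have hIco : Ico L.t0 (L.T + L.t0) ∈ 𝓝[<] (L.T + L.t0) := Ico_mem_nhdsLT hlt
  have h1 : Tendsto (errNorm L S z) (𝓝[<] (L.T + L.t0)) (𝓝 (errNorm L S z (L.T + L.t0))) :=
    ((hS.errNorm_continuousOn (z := z)) _ hT).mono_left
      (nhdsWithin_le_of_mem (mem_of_superset hIco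
        (Ico_subset_Icc_self.trans (Icc_subset_timeDom hT))))
  have h2 : Tendsto (fun t => t - L.t0) (𝓝[<] (L.T + L.t0)) (𝓝[<] L.T) := by
    refine tendsto_nhdsWithin_of_tendsto_nhds_of_eventually_within _ ?_ ?_
    · have : Tendsto (fun t => t - L.t0) (𝓝 (L.T + L.t0)) (𝓝 (L.T + L.t0 - L.t0)) :=
        (continuous_sub_right L.t0).tendsto _
      rw [add_sub_cancel_right] at this
      exact this.mono_left nhdsWithin_le_nhds
    · filter_upwards [self_mem_nhdsWithin] with t ht
      have : t < L.T + L.t0 := ht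
      change t - L.t0 < L.T
      linarith
  have h3 := (((H.gain.decay_tendsto hq).comp h2).const_mul (K1 * errNorm L S z L.t0 + K2))
  rw [mul_zero] at h3
  refine le_antisymm (le_of_tendsto_of_tendsto h1 h3 ?_) (Real.sqrt_nonneg _)
  filter_upwards [hIco] with t ht
  exact h S tEnd hS hv le_rfl t (Icc_subset_timeDom hT ⟨ht.1, ht.2.le⟩) ht.2

/-- From the prescribed time on, all states rest at the equilibrium. -/
theorem Assumptions.rest (H : Assumptions L bt ρ kl ku ρc vc cst k1st k2st)
    (hz : ∑ i, gradient (L.f i) z = 0) (hS : IsSolution L S tEnd) (hv : ∑ i, S.v L.t0 i = 0)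
    {t : ℝ} (ht : t ∈ timeDom L.t0 tEnd) (htT : L.T + L.t0 ≤ t) (i : Fin N) :
    S.ϖ t i = z ∧ S.v t i = -gradient (L.f i) z ∧ S.q t i = z ∧ S.dq t i = 0 := by
  have hlt : L.t0 < L.T + L.t0 := by linarith [H.T_pos]
  have hsub : Icc (L.T + L.t0) t ⊆ timeDom L.t0 tEnd :=
    (Icc_subset_Icc_left hlt.le).trans (Icc_subset_timeDom ht)
  have hT : L.T + L.t0 ∈ timeDom L.t0 tEnd := hsub ⟨le_rfl, htT⟩
  obtain ⟨e1, e2, e3, e4⟩ := eq_of_errNorm_eq_zero (H.errNorm_eq_zero hz hS hv hT) i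
  have hIci : ∀ u ∈ Ico (L.T + L.t0) t, Ici u ⊆ Ici (L.T + L.t0) :=
    fun u hu => Ici_subset_Ici.2 hu.1
  have c1 := constant_of_has_deriv_right_zero ((hS.ϖ_cont i).mono hsub)
    (fun u hu => (hS.ϖ_eq' u (hsub ⟨hu.1, hu.2.le⟩) hu.1 i).mono (hIci u hu)) t ⟨htT, le_rfl⟩
  have c2 := constant_of_has_deriv_right_zero ((hS.v_cont i).mono hsub)
    (fun u hu => (hS.v_eq' u (hsub ⟨hu.1, hu.2.le⟩) hu.1 i).mono (hIci u hu)) t ⟨htT, le_rfl⟩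
  -- With zero input the kinetic energy is conserved. It is zero at `T + t₀`, and `M ≥ kl I` forces
  -- the velocity to vanish.
  have hE : ∀ u ∈ Icc (L.T + L.t0) t, HasDerivWithinAt
      (fun u => 1 / 2 * inner ℝ (S.dq u i) ((L.plant i).M (S.q u i) (S.dq u i))) 0
      (Ici (L.T + L.t0)) u := by
    intro u hu
    refine (hasDerivWithinAt_energy (H.skew i) (H.inertia i)
      ((hS.pos_eq u (hsub hu) i).mono (Ici_subset_Ici.2 hlt.le))
      (hS.vel_eq' u (hsub hu) hu.1 i)).congr_deriv ?_
    rw [hS.euler_lagrange u (hsub hu) i, τ, if_neg hu.1.not_gt, inner_zero_right]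
  have hdq : ∀ u ∈ Icc (L.T + L.t0) t, S.dq u i = 0 := by
    intro u hu
    have c3 := constant_of_has_deriv_right_zero
      (fun u hu => (hE u hu).continuousWithinAt.mono Icc_subset_Ici_self)
      (fun u hu => (hE u ⟨hu.1, hu.2.le⟩).mono (hIci u hu)) u hu
    rw [e4, inner_zero_left, mul_zero] at c3
    have h1 := (H.inertia i).le_inner (S.q u i) (S.dq u i)
    have h2 : ‖S.dq u i‖ ^ 2 ≤ 0 := by
      by_contra! hcon
      have := mul_pos (H.inertia i).kl_pos hcon
      linarith
    exact norm_eq_zero.1 (pow_eq_zero_iff two_ne_zero |>.1 (le_antisymm h2 (sq_nonneg _)))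
  have c4 := constant_of_has_deriv_right_zero ((hS.q_continuousOn i).mono hsub)
    (fun u hu => by
      have h := (hS.pos_eq u (hsub ⟨hu.1, hu.2.le⟩) i).mono (Ici_subset_Ici.2 (hlt.le.trans hu.1))
      rwa [hdq u ⟨hu.1, hu.2.le⟩] at h) t ⟨htT, le_rfl⟩
  exact ⟨c1.trans e1, c2.trans e2, c4.trans e3, hdq t ⟨htT, le_rfl⟩⟩

theorem errNorm_eq_zero_of_rest {t : ℝ} (h : ∀ i, S.ϖ t i = z ∧ S.v t i = -gradient (L.f i) z
    ∧ S.q t i = z ∧ S.dq t i = 0) : errNorm L S z t = 0 := by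
  rw [errNorm, Real.sqrt_eq_zero', Finset.sum_eq_zero]
  intro i _
  obtain ⟨h1, h2, h3, h4⟩ := h i
  rw [Signals.y, h1, h2, h3, h4]
  simp

theorem Assumptions.tendsto_output (H : Assumptions L bt ρ kl ku ρc vc cst k1st k2st)
    (hz : ∑ i, gradient (L.f i) z = 0) (hS : IsSolution L S tEnd) (hv : ∑ i, S.v L.t0 i = 0)
    (hT : ((L.T + L.t0 : ℝ) : EReal) < tEnd) (i : Fin N) :
    Tendsto (fun t => S.y t i) (𝓝 (L.T + L.t0)) (𝓝 z) := by
  have hlt : L.t0 < L.T + L.t0 := by linarith [H.T_pos]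
  -- The solution extends beyond `T + t₀`, so continuity there is two-sided and the value is known
  -- from `rest`.
  have hc := (hS.pos_eq _ ⟨hlt.le, hT⟩ i).continuousWithinAt.continuousAt (Ici_mem_nhds hlt)
  have h := hc.tendsto
  rwa [(H.rest hz hS hv ⟨hlt.le, hT⟩ le_rfl i).2.2.1] at h

end Convergence

/-! ### Boundedness of the signals -/

section Boundedness

open Asymptotics

variable {N n p : ℕ} {L : Loop N n p} {S : Signals N n p} {z : Vec n}
variable {bt ρc vc cst : ℝ} {ρ kl ku k1st k2st : Fin N → ℝ} {tEnd : EReal}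

/-- Boundedness on a set, phrased so that the calculus of `IsBigO` handles sums and products. -/
theorem isBigO_one_principal_iff {E : Type*} [SeminormedAddCommGroup E] {D : Set ℝ} {f : ℝ → E} :
    f =O[𝓟 D] (fun _ => (1 : ℝ)) ↔ ∃ B, ∀ t ∈ D, ‖f t‖ ≤ B := by
  rw [isBigO_principal]
  simp only [norm_one, mul_one]

theorem isBigO_smul_of_one {E : Type*} [SeminormedAddCommGroup E] [NormedSpace ℝ E] {D : Set ℝ}
    {k : ℝ → ℝ} {f : ℝ → E} (hk : k =O[𝓟 D] (fun _ => (1 : ℝ)))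
    (hf : f =O[𝓟 D] (fun _ => (1 : ℝ))) : (fun t => k t • f t) =O[𝓟 D] (fun _ => (1 : ℝ)) := by
  simpa using hk.smul hf

/-- The times of the solution before the prescribed time. -/
def earlyTimes (L : Loop N n p) (tEnd : EReal) : Set ℝ :=
  {t | t ∈ timeDom L.t0 tEnd ∧ t < L.T + L.t0}

theorem Assumptions.scaled_isBigO (H : Assumptions L bt ρ kl ku ρc vc cst k1st k2st)
    (hz : ∑ i, gradient (L.f i) z = 0) (hS : IsSolution L S tEnd) (hv : ∑ i, S.v L.t0 i = 0)
    (i : Fin N) :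
    (fun t => scaledRef L S z t i) =O[𝓟 (earlyTimes L tEnd)] (fun _ => (1 : ℝ)) ∧
    (fun t => scaledInt L S z t i) =O[𝓟 (earlyTimes L tEnd)] (fun _ => (1 : ℝ)) ∧
    (fun t => scaledGap L S t i) =O[𝓟 (earlyTimes L tEnd)] (fun _ => (1 : ℝ)) ∧
    (fun t => scaledSlide L S t i) =O[𝓟 (earlyTimes L tEnd)] (fun _ => (1 : ℝ)) ∧
    (fun t => S.θhat t i) =O[𝓟 (earlyTimes L tEnd)] (fun _ => (1 : ℝ)) := by
  obtain ⟨C, hC, h⟩ := H.exists_scaledErr_le hz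
  set Q := C * (errNorm L S z L.t0 ^ 2 + estErrNorm L S L.t0 ^ 2 + 1)
  have hle : ∀ t ∈ earlyTimes L tEnd, ‖scaledRef L S z t i‖ ^ 2 + ‖scaledInt L S z t i‖ ^ 2
      + ‖scaledGap L S t i‖ ^ 2 + ‖scaledSlide L S t i‖ ^ 2
      + ‖(L.plant i).θ - S.θhat t i‖ ^ 2 ≤ Q := fun t ht =>
    (Finset.single_le_sum (f := fun i => ‖scaledRef L S z t i‖ ^ 2 + ‖scaledInt L S z t i‖ ^ 2
      + ‖scaledGap L S t i‖ ^ 2 + ‖scaledSlide L S t i‖ ^ 2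
      + ‖(L.plant i).θ - S.θhat t i‖ ^ 2) (fun i _ => by positivity) (Finset.mem_univ i)).trans
      (h S tEnd hS hv t ht.1 ht.2)
  have key : ∀ {m : ℕ} (f : ℝ → Vec m), (∀ t ∈ earlyTimes L tEnd, ‖f t‖ ^ 2 ≤ Q) →
      f =O[𝓟 (earlyTimes L tEnd)] (fun _ => (1 : ℝ)) := fun f hf =>
    isBigO_one_principal_iff.2 ⟨Real.sqrt Q, fun t ht => Real.le_sqrt_of_sq_le (hf t ht)⟩
  have hθ : (fun t => (L.plant i).θ - S.θhat t i) =O[𝓟 (earlyTimes L tEnd)]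
      (fun _ => (1 : ℝ)) := key _ fun t ht => by
    have := hle t ht; nlinarith [sq_nonneg ‖scaledRef L S z t i‖, sq_nonneg ‖scaledInt L S z t i‖,
      sq_nonneg ‖scaledGap L S t i‖, sq_nonneg ‖scaledSlide L S t i‖]
  refine ⟨key _ fun t ht => ?_, key _ fun t ht => ?_, key _ fun t ht => ?_, key _ fun t ht => ?_, ?_⟩
  iterate 4
    have := hle t ht
    nlinarith [sq_nonneg ‖scaledRef L S z t i‖, sq_nonneg ‖scaledInt L S z t i‖,
      sq_nonneg ‖scaledGap L S t i‖, sq_nonneg ‖scaledSlide L S t i‖,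
      sq_nonneg ‖(L.plant i).θ - S.θhat t i‖]
  have hc : (fun _ : ℝ => (L.plant i).θ) =O[𝓟 (earlyTimes L tEnd)] (fun _ => (1 : ℝ)) :=
    isBigO_one_principal_iff.2 ⟨_, fun _ _ => le_rfl⟩
  simpa using hc.sub hθ

theorem Assumptions.rpow_isBigO (H : Assumptions L bt ρ kl ku ρc vc cst k1st k2st) {q : ℝ}
    (hq : q ≤ 0) :
    (fun t => L.μ t ^ q) =O[𝓟 (earlyTimes L tEnd)] (fun _ => (1 : ℝ)) := by
  refine isBigO_one_principal_iff.2 ⟨L.μ L.t0 ^ q, fun t ht => ?_⟩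
  have htp : t ∈ Tp L.t0 L.T := ⟨ht.1.1, ht.2⟩
  rw [Real.norm_of_nonneg (Real.rpow_nonneg (H.gain.pos htp).le _)]
  exact Real.rpow_le_rpow_of_nonpos (H.gain.init_pos H.T_pos) (H.gain.init_le htp) hq

/-- A signal is bounded if its product with a nonnegative power of `μ` is. -/
theorem Assumptions.isBigO_of_rpow_smul (H : Assumptions L bt ρ kl ku ρc vc cst k1st k2st)
    {E : Type*} [NormedAddCommGroup E] [NormedSpace ℝ E] {f g : ℝ → E} {q : ℝ} (hq : q ≤ 0)
    (hf : f =O[𝓟 (earlyTimes L tEnd)] (fun _ => (1 : ℝ)))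
    (hfg : ∀ t ∈ Tp L.t0 L.T, g t = L.μ t ^ q • f t) :
    g =O[𝓟 (earlyTimes L tEnd)] (fun _ => (1 : ℝ)) := by
  refine (isBigO_smul_of_one (H.rpow_isBigO hq) hf).congr' ?_ EventuallyEq.rfl
  exact eventuallyEq_principal.2 fun t ht => (hfg t ⟨ht.1.1, ht.2⟩).symm

theorem Plant.RegressionProperty.isBigO {P : Plant n p} {ρ : ℝ} (hP : P.RegressionProperty ρ)
    {D : Set ℝ} {q dq x y : ℝ → Vec n} (h1 : dq =O[𝓟 D] (fun _ => (1 : ℝ)))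
    (h2 : x =O[𝓟 D] (fun _ => (1 : ℝ))) (h3 : y =O[𝓟 D] (fun _ => (1 : ℝ))) :
    (fun t => P.Ω (q t) (dq t) (x t) (y t)) =O[𝓟 D] (fun _ => (1 : ℝ)) := by
  obtain ⟨B1, h1⟩ := isBigO_one_principal_iff.1 h1
  obtain ⟨B2, h2⟩ := isBigO_one_principal_iff.1 h2
  obtain ⟨B3, h3⟩ := isBigO_one_principal_iff.1 h3
  refine isBigO_one_principal_iff.2
    ⟨ρ * (Real.sqrt (B1 ^ 2 + B2 ^ 2 + B3 ^ 2) + (B1 ^ 2 + B2 ^ 2 + B3 ^ 2)), fun t ht => ?_⟩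
  have hs : ‖dq t‖ ^ 2 + ‖x t‖ ^ 2 + ‖y t‖ ^ 2 ≤ B1 ^ 2 + B2 ^ 2 + B3 ^ 2 := by
    gcongr
    exacts [h1 t ht, h2 t ht, h3 t ht]
  refine (hP.bound _ _ _ _).trans (mul_le_mul_of_nonneg_left ?_ hP.ρ_pos.le)
  exact add_le_add (Real.sqrt_le_sqrt hs) hs

theorem Assumptions.early_isBigO (H : Assumptions L bt ρ kl ku ρc vc cst k1st k2st)
    (hz : ∑ i, gradient (L.f i) z = 0) (hS : IsSolution L S tEnd) (hv : ∑ i, S.v L.t0 i = 0)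
    (i : Fin N) :
    (fun t => S.q t i) =O[𝓟 (earlyTimes L tEnd)] (fun _ => (1 : ℝ)) ∧
    (fun t => S.dq t i) =O[𝓟 (earlyTimes L tEnd)] (fun _ => (1 : ℝ)) ∧
    (fun t => τ L S t i) =O[𝓟 (earlyTimes L tEnd)] (fun _ => (1 : ℝ)) ∧
    (fun t => S.ϖ t i) =O[𝓟 (earlyTimes L tEnd)] (fun _ => (1 : ℝ)) ∧
    (fun t => S.v t i) =O[𝓟 (earlyTimes L tEnd)] (fun _ => (1 : ℝ)) ∧
    (fun t => S.θhat t i) =O[𝓟 (earlyTimes L tEnd)] (fun _ => (1 : ℝ)) := by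
  obtain ⟨h1, h2, h3, h4, h5⟩ := H.scaled_isBigO hz hS hv i
  have hι := H.criteria.dc1
  have hc : ∀ a : Vec n, (fun _ : ℝ => a) =O[𝓟 (earlyTimes L tEnd)] (fun _ => (1 : ℝ)) :=
    fun a => isBigO_one_principal_iff.2 ⟨_, fun _ _ => le_rfl⟩
  have hcr : ∀ a : ℝ, (fun _ : ℝ => a) =O[𝓟 (earlyTimes L tEnd)] (fun _ => (1 : ℝ)) :=
    fun a => isBigO_one_principal_iff.2 ⟨_, fun _ _ => le_rfl⟩
  have hpow : ∀ t ∈ Tp L.t0 L.T, ∀ (a b : ℝ), L.μ t ^ a * L.μ t ^ b = L.μ t ^ (a + b) :=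
    fun t ht a b => (Real.rpow_add (H.gain.pos ht) a b).symm
  have hinv : ∀ t ∈ Tp L.t0 L.T, L.μ t ^ (-L.η.ι) * L.μ t ^ L.η.ι = 1 := fun t ht => by
    rw [hpow t ht, neg_add_cancel, Real.rpow_zero]
  have hmul : ∀ t ∈ Tp L.t0 L.T, ∀ a : ℝ, L.μ t * L.μ t ^ a = L.μ t ^ (a + 1) := fun t ht a => by
    rw [Real.rpow_add_one (H.gain.pos ht).ne', mul_comm]
  have w1 : (fun t => S.ϖ t i) =O[𝓟 (earlyTimes L tEnd)] (fun _ => (1 : ℝ)) := by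
    have : (fun t => S.ϖ t i - z) =O[𝓟 (earlyTimes L tEnd)] (fun _ => (1 : ℝ)) :=
      H.isBigO_of_rpow_smul (q := -L.η.ι) (by linarith) h1 fun t ht => by
        rw [scaledRef, smul_smul, hinv t ht, one_smul]
    simpa using this.add (hc z)
  have w2 : (fun t => S.v t i) =O[𝓟 (earlyTimes L tEnd)] (fun _ => (1 : ℝ)) := by
    have : (fun t => S.v t i + gradient (L.f i) z) =O[𝓟 (earlyTimes L tEnd)]
        (fun _ => (1 : ℝ)) :=
      H.isBigO_of_rpow_smul (q := -L.η.ι) (by linarith) h2 fun t ht => by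
        rw [scaledInt, smul_smul, hinv t ht, one_smul]
    simpa using this.sub (hc (gradient (L.f i) z))
  have w3 : (fun t => S.q t i) =O[𝓟 (earlyTimes L tEnd)] (fun _ => (1 : ℝ)) := by
    have : (fun t => S.q t i - S.ϖ t i) =O[𝓟 (earlyTimes L tEnd)] (fun _ => (1 : ℝ)) :=
      H.isBigO_of_rpow_smul (q := -L.η.ι) (by linarith) h3 fun t ht => by
        rw [scaledGap, smul_smul, hinv t ht, one_smul]
    simpa using this.add w1
  -- Here `ι > 2` is needed: one power of `μ` on `s`, and below two powers on the gap, leave the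
  -- factor `μ^(2-ι)`.
  have s1 : (fun t => L.μ t • (S.dq t i + (L.η.k1 i * L.μ t) • (S.q t i - S.ϖ t i)))
      =O[𝓟 (earlyTimes L tEnd)] (fun _ => (1 : ℝ)) :=
    H.isBigO_of_rpow_smul (q := 2 - L.η.ι) (by linarith) h4 fun t ht => by
      rw [scaledSlide, smul_smul, hpow t ht, show 2 - L.η.ι + (L.η.ι - 1) = 1 by ring,
        Real.rpow_one]
  have s2 : (fun t => L.μ t ^ 2 • (S.q t i - S.ϖ t i))
      =O[𝓟 (earlyTimes L tEnd)] (fun _ => (1 : ℝ)) :=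
    H.isBigO_of_rpow_smul (q := 2 - L.η.ι) (by linarith) h3 fun t ht => by
      rw [scaledGap, smul_smul, hpow t ht, sub_add_cancel, Real.rpow_two]
  have s3 : (fun t => L.μ t • S.dq t i) =O[𝓟 (earlyTimes L tEnd)] (fun _ => (1 : ℝ)) := by
    refine (s1.sub (isBigO_smul_of_one (hcr (L.η.k1 i)) s2)).congr_left fun t => ?_
    module
  have s4 : (fun t => S.dq t i) =O[𝓟 (earlyTimes L tEnd)] (fun _ => (1 : ℝ)) :=
    H.isBigO_of_rpow_smul (q := -1) (by linarith) s3 fun t ht => by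
      rw [smul_smul, Real.rpow_neg_one, inv_mul_cancel₀ (H.gain.pos ht).ne', one_smul]
  have s5 : (fun t => z2 L S t i) =O[𝓟 (earlyTimes L tEnd)] (fun _ => (1 : ℝ)) :=
    H.isBigO_of_rpow_smul (q := -1) (by linarith) (isBigO_smul_of_one (hcr (L.η.k1 i)) s2)
      fun t ht => by
        have := (H.gain.pos ht).ne'
        rw [z2, Signals.y, smul_smul, smul_smul, Real.rpow_neg_one]
        congr 1
        field_simp
  -- The factor `μ̃` in `z₁` may be unbounded, but `μ̃/μ = μ'/μ² ≤ b̃`; the missing `μ` is supplied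
  -- by the bounds on `μ q'` and `μ² (y - ϖ)`.
  have hν : (fun t => muTilde L t / L.μ t) =O[𝓟 (earlyTimes L tEnd)] (fun _ => (1 : ℝ)) := by
    refine isBigO_one_principal_iff.2 ⟨bt, fun t ht => ?_⟩
    have htp : t ∈ Tp L.t0 L.T := ⟨ht.1.1, ht.2⟩
    have hp := H.gain.pos htp
    have hr := H.gain.rate_nonneg t
    rw [muTilde, div_div, Real.norm_of_nonneg (by positivity), div_le_iff₀ (by positivity), ← sq]
    exact H.gain.rate_le t htp
  have s6 : (fun t => z1 L S t i) =O[𝓟 (earlyTimes L tEnd)] (fun _ => (1 : ℝ)) := by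
    have a1 := isBigO_smul_of_one (hcr (L.η.ι - 1)) (isBigO_smul_of_one hν s3)
    have a2 := isBigO_smul_of_one (hcr (L.η.k1 i)) s3
    have a3 := isBigO_smul_of_one (hcr (L.η.ι * L.η.k1 i)) (isBigO_smul_of_one hν s2)
    refine ((a1.add a2).add a3).congr' ?_ EventuallyEq.rfl
    refine eventuallyEq_principal.2 fun t ht => ?_
    have hp := (H.gain_pos ht.1 ht.2).ne'
    simp only [z1, Signals.y]
    match_scalars <;> field_simp
  have s7 : (fun t => regr L S t i) =O[𝓟 (earlyTimes L tEnd)] (fun _ => (1 : ℝ)) :=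
    (H.regression i).isBigO s4 s6 s5
  have s8 : (fun t => regr L S t i (S.θhat t i)) =O[𝓟 (earlyTimes L tEnd)]
      (fun _ => (1 : ℝ)) := by
    have h := s7.norm_left.mul h5.norm_left
    simp only [mul_one] at h
    refine IsBigO.trans (isBigO_of_le _ fun t => ?_) h
    rw [norm_mul, norm_norm, norm_norm]
    exact (regr L S t i).le_opNorm _
  have s9 : (fun t => τ L S t i) =O[𝓟 (earlyTimes L tEnd)] (fun _ => (1 : ℝ)) := by
    refine ((isBigO_smul_of_one (hcr (-L.η.k2 i)) s1).sub s8).congr' ?_ EventuallyEq.rfl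
    refine eventuallyEq_principal.2 fun t ht => ?_
    simp only [τ, if_pos ht.2, ctrl, Signals.y]
    module
  exact ⟨w3, s4, s9, w1, w2, h5⟩

theorem exists_bound_of_early {E : Type*} [SeminormedAddCommGroup E] {f : ℝ → E} {a : E}
    (h1 : f =O[𝓟 (earlyTimes L tEnd)] (fun _ => (1 : ℝ)))
    (h2 : ∀ t ∈ timeDom L.t0 tEnd, L.T + L.t0 ≤ t → f t = a) :
    ∃ B, ∀ t ∈ timeDom L.t0 tEnd, ‖f t‖ ≤ B := by
  obtain ⟨B, hB⟩ := isBigO_one_principal_iff.1 h1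
  refine ⟨max B ‖a‖, fun t ht => ?_⟩
  rcases lt_or_ge t (L.T + L.t0) with h | h
  · exact (hB t ⟨ht, h⟩).trans (le_max_left _ _)
  · rw [h2 t ht h]; exact le_max_right _ _

theorem Assumptions.exists_bound (H : Assumptions L bt ρ kl ku ρc vc cst k1st k2st)
    (hz : ∑ i, gradient (L.f i) z = 0) (hS : IsSolution L S tEnd) (hv : ∑ i, S.v L.t0 i = 0) :
    ∃ B : ℝ, ∀ t ∈ timeDom L.t0 tEnd, ∀ i,
      ‖S.q t i‖ ≤ B ∧ ‖S.dq t i‖ ≤ B ∧ ‖τ L S t i‖ ≤ B ∧ ‖S.ϖ t i‖ ≤ B ∧ ‖S.v t i‖ ≤ B ∧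
      (t < L.T + L.t0 → ‖S.θhat t i‖ ≤ B) := by
  have hrest := fun i t ht htT => H.rest hz hS hv (t := t) ht htT i
  have hE := H.early_isBigO hz hS hv
  choose B1 h1 using fun i => exists_bound_of_early (hE i).1
    fun t ht htT => (hrest i t ht htT).2.2.1
  choose B2 h2 using fun i => exists_bound_of_early (hE i).2.1
    fun t ht htT => (hrest i t ht htT).2.2.2
  choose B3 h3 using fun i => exists_bound_of_early (a := 0) (hE i).2.2.1
    fun t ht htT => if_neg htT.not_gt
  choose B4 h4 using fun i => exists_bound_of_early (hE i).2.2.2.1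
    fun t ht htT => (hrest i t ht htT).1
  choose B5 h5 using fun i => exists_bound_of_early (hE i).2.2.2.2.1
    fun t ht htT => (hrest i t ht htT).2.1
  choose B6 h6 using fun i => isBigO_one_principal_iff.1 (hE i).2.2.2.2.2
  obtain ⟨C1, -, c1⟩ := exists_pos_forall_ge B1
  obtain ⟨C2, -, c2⟩ := exists_pos_forall_ge B2
  obtain ⟨C3, -, c3⟩ := exists_pos_forall_ge B3
  obtain ⟨C4, -, c4⟩ := exists_pos_forall_ge B4
  obtain ⟨C5, -, c5⟩ := exists_pos_forall_ge B5
  obtain ⟨C6, -, c6⟩ := exists_pos_forall_ge B6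
  refine ⟨max (max (max C1 C2) (max C3 C4)) (max C5 C6), fun t ht i =>
    ⟨(h1 i t ht).trans ?_, (h2 i t ht).trans ?_, (h3 i t ht).trans ?_, (h4 i t ht).trans ?_,
      (h5 i t ht).trans ?_, fun htT => (h6 i t ⟨ht, htT⟩).trans ?_⟩⟩
  · exact (c1 i).trans (by simp)
  · exact (c2 i).trans (by simp)
  · exact (c3 i).trans (by simp)
  · exact (c4 i).trans (by simp)
  · exact (c5 i).trans (by simp)
  · exact (c6 i).trans (by simp)

end Boundedness

end DPTCO

/-! ### Assembly of the main theorem -/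

theorem theorem2 {N n p : ℕ} (hN : 2 ≤ N) (L : DPTCO.Loop N n p)
    (hT : 0 < L.T)
    (bt : ℝ) (hμ : DPTCO.ClassKT L.t0 L.T bt L.μ)
    (ρ kl ku : Fin N → ℝ)
    (hprop1 : ∀ i, (L.plant i).SkewProperty)
    (hprop2 : ∀ i, (L.plant i).RegressionProperty (ρ i))
    (hprop3 : ∀ i, (L.plant i).InertiaProperty (kl i) (ku i))
    (hgraph : L.G.graph.Connected)
    (hsolv : DPTCO.Solvable L.f)
    (ρc vc : ℝ) (hcost : DPTCO.CostAssumption L.f ρc vc)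
    (cst : ℝ) (k1st k2st : Fin N → ℝ)
    (hdc : DPTCO.DesignCriteria L.G ρc vc bt ku L.η cst k1st k2st) :
    ∃ z : DPTCO.Vec n,
      -- the optimal solution is unique, of the form `1_N ⊗ z`
      DPTCO.optSet L.f = {fun _ => z} ∧
      -- prescribed-time convergence, and rest at the optimum afterwards
      (∀ (S : DPTCO.Signals N n p) (tEnd : EReal),
        ((L.T + L.t0 : ℝ) : EReal) < tEnd → DPTCO.IsSolution L S tEnd →
        ∑ i, S.v L.t0 i = 0 →
          (∀ i, Tendsto (fun t => S.y t i) (𝓝 (L.T + L.t0)) (𝓝 z)) ∧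
          (∀ t ∈ DPTCO.timeDom L.t0 tEnd, L.T + L.t0 ≤ t → ∀ i, S.y t i = z)) ∧
      -- boundedness of all internal signals
      (∀ (S : DPTCO.Signals N n p) (tEnd : EReal),
        (L.t0 : EReal) < tEnd → DPTCO.IsSolution L S tEnd → ∑ i, S.v L.t0 i = 0 →
          ∃ B : ℝ, ∀ t ∈ DPTCO.timeDom L.t0 tEnd, ∀ i,
            ‖S.q t i‖ ≤ B ∧ ‖S.dq t i‖ ≤ B ∧ ‖DPTCO.τ L S t i‖ ≤ B ∧
            ‖S.ϖ t i‖ ≤ B ∧ ‖S.v t i‖ ≤ B ∧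
            (t < L.T + L.t0 → ‖S.θhat t i‖ ≤ B)) ∧
      -- the error is bounded by a class `𝒦ℒ_T^e` function, which depends on the solution only
      -- through (an upper bound for) the initial estimation error
      (∀ R : ℝ, ∃ β : ℝ → ℝ → ℝ, DPTCO.ClassKLTE L.T β ∧
        ∀ (S : DPTCO.Signals N n p) (tEnd : EReal),
          (L.t0 : EReal) < tEnd → DPTCO.IsSolution L S tEnd → ∑ i, S.v L.t0 i = 0 →
          DPTCO.estErrNorm L S L.t0 ≤ R →
          ∀ t ∈ DPTCO.timeDom L.t0 tEnd,
            DPTCO.errNorm L S z t ≤ β (DPTCO.errNorm L S z L.t0) (t - L.t0)) := by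
  have H : DPTCO.Assumptions L bt ρ kl ku ρc vc cst k1st k2st :=
    ⟨hN, hT, hμ, hprop1, hprop2, hprop3, hgraph, hcost, hdc⟩
  have hq : 0 < L.η.ι - 1 := by linarith [hdc.dc1]
  obtain ⟨z, hopt, hz⟩ := DPTCO.exists_optimum hN hsolv hcost
  refine ⟨z, hopt, fun S tEnd htE hS hv => ⟨H.tendsto_output hz hS hv htE, fun t ht htT i =>
    (H.rest hz hS hv ht htT i).2.2.1⟩, fun S tEnd _ hS hv => H.exists_bound hz hS hv, fun R => ?_⟩
  obtain ⟨K1, K2, hK1, hK2, h⟩ := H.exists_errNorm_le_decay hz R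
  -- The bound is fixed by `R` before the solution and its end time; from `T + t₀` on both sides of
  -- the inequality are zero.
  refine ⟨_, hμ.classKLTE hq hK1 hK2, fun S tEnd _ hS hv hR t ht => ?_⟩
  rcases lt_or_ge t (L.T + L.t0) with htT | htT
  · exact h S tEnd hS hv hR t ht htT
  · rw [DPTCO.errNorm_eq_zero_of_rest (H.rest hz hS hv ht htT),
      DPTCO.decay_of_le (by linarith), mul_zero]
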